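/- Let $H=(V,\mathcal{E})$ be a finite $3$-uniform hypergraph with at least one hyperedge, that is, $V$ is a finite set and $\mathcal{E}$ is a non-empty finite family of $3$-element subsets of $V$ (parallel hyperedges, i.e. repeated members of the family, are allowed). The degree of a node $v\in V$ is the number of hyperedges containing $v$, counted with multiplicity. An extended matching of $H$ is a collection of pairwise disjoint subsets of $V$, each of which is either a hyperedge of $H$ or a pair $\{u,v\}$ of distinct nodes such that $u,v\in e$ for some hyperedge $e\in\mathcal{E}$. Then $H$ has an extended matching that covers every node of maximum degree, i.e. every node $v$ whose degree is the largest among all nodes of $H$ belongs to some member of the collection. -/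

import Mathlib

/-- A hypergraph with node type `V` and hyperedges indexed by `E`. Distinct indices may carry the
same node set, so parallel hyperedges are allowed; a hypergraph without parallel hyperedges is one
whose function `edge` is injective. -/
structure MultiHypergraph (V E : Type*) where
  edge : E → Finset V

namespace MultiHypergraph

variable {V E : Type*}

/-- Every hyperedge has exactly `k` nodes. -/
def IsUniform (H : MultiHypergraph V E) (k : ℕ) : Prop :=
  ∀ e, (H.edge e).card = k

/-- The degree of a node: the number of hyperedges containing it, counted with multiplicity. -/
def degree [Fintype E] [DecidableEq V] (H : MultiHypergraph V E) (v : V) : ℕ :=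
  (Finset.univ.filter fun e => v ∈ H.edge e).card

/-- A node is of maximum degree if no node has larger degree. -/
def IsMaxDegree [Fintype E] [DecidableEq V] (H : MultiHypergraph V E) (v : V) : Prop :=
  ∀ u, H.degree u ≤ H.degree v

/-- An extended matching: a collection of pairwise disjoint node sets, each of which is either a
hyperedge or a pair of two distinct nodes contained in a common hyperedge. -/
def IsExtendedMatching (H : MultiHypergraph V E) (M : Finset (Finset V)) : Prop :=
  (∀ s ∈ M, (∃ e, s = H.edge e) ∨ (s.card = 2 ∧ ∃ e, s ⊆ H.edge e)) ∧
    (M : Set (Finset V)).Pairwise Disjoint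

end MultiHypergraph

/-!
Let `Δ` be the maximum degree and `G` the graph whose edges are the pairs of nodes lying in a common
hyperedge. By Tutte's theorem there are a separator `S` and a partition `𝒦` of the remaining nodes
into factor-critical sets with no edges of `G` between them, such that `|𝒦| - |S|` is as large as
possible. A set `K ∈ 𝒦` together with an adjacent `s ∈ S` has a perfect matching, and `K` alone can
be covered unless it is obstructed: all its nodes have degree `Δ`, and no hyperedge `e ⊆ K` leaves a
perfectly matchable `K \ e`. By Hall's theorem it suffices to match the obstructed members of `𝒦`
into `S`. As a node of `S` lies in at most `Δ` hyperedges, it is enough that the hyperedges meeting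
an obstructed `K` have at least `Δ` incidences outside `K`.

For a single node this is clear. Otherwise it follows from a weight `y ≤ 1` on `K` of total at least
`2` that is nonpositive on every hyperedge inside `K`: a hyperedge leaving `K` has one or two nodes
outside and weight at most two or one inside, so
`2 * Δ ≤ ∑ v ∈ K, y v * deg v = ∑ e, y (e ∩ K) ≤ 2 * ∑ e, |e \ K|`,
the last sum being over the hyperedges that meet `K`.

Such a weight exists on every factor-critical graph with at least three vertices if it need only be
nonpositive on the triangles whose removal leaves no perfect matching, and it is built by induction.
If there is no such triangle, take `y = 1`. Otherwise a minimal barrier for such a triangle yields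
either an end attached at only two vertices, where the induction hypothesis applies to both sides
after contraction, or two disjoint ends with common attachments; rooted weights on the pieces are
then glued together.
-/

namespace ExtendedMatching

open Finset SimpleGraph

/-! ### Matchings and factor-critical sets -/

section Matchable

variable {V : Type*} {G G' : SimpleGraph V}

/-- The subgraph of `G` induced on `U` has a perfect matching. -/
def Matchable (G : SimpleGraph V) (U : Finset V) : Prop :=
  ∃ M : G.Subgraph, M.verts = U ∧ M.IsMatching

lemma isMatching_induce_of_closed {M : G.Subgraph} (hM : M.IsMatching) {A : Set V}
    (hA : A ⊆ M.verts) (hclosed : ∀ a ∈ A, ∀ b, M.Adj a b → b ∈ A) :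
    (M.induce A).IsMatching := by
  intro a ha
  obtain ⟨b, hab, huniq⟩ := hM (hA ha)
  exact ⟨b, ⟨ha, hclosed a ha b hab, hab⟩, fun c hac => huniq c hac.2.2⟩

lemma Matchable.mono {U : Finset V} (h : Matchable G U)
    (hG : ∀ u ∈ U, ∀ v ∈ U, G.Adj u v → G'.Adj u v) : Matchable G' U := by
  obtain ⟨M, hMU, hM⟩ := h
  have hmem : ∀ {u v}, M.Adj u v → u ∈ U := fun huv => by
    simpa [hMU] using M.edge_vert huv
  exact ⟨{ verts := U
           Adj := M.Adj
           adj_sub := fun huv => hG _ (hmem huv) _ (hmem huv.symm) huv.adj_sub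
           edge_vert := hmem
           symm := M.symm }, rfl, fun v hv => hM (by rwa [hMU])⟩

lemma Matchable.congr {A U : Finset V} (hA : Matchable G A) (hU : ∀ v, v ∈ U ↔ v ∈ A) :
    Matchable G U := by
  rwa [show U = A from ext hU]

lemma Matchable.even_card {U : Finset V} (h : Matchable G U) : Even U.card := by
  classical
  obtain ⟨M, hMU, hM⟩ := h
  have : Fintype M.verts := by rw [hMU]; infer_instance
  simpa [hMU] using hM.even_card

lemma Matchable.union [DecidableEq V] {A B : Finset V} (hA : Matchable G A) (hB : Matchable G B)
    (hd : Disjoint A B) : Matchable G (A ∪ B) := by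
  obtain ⟨M, hMA, hM⟩ := hA
  obtain ⟨N, hNB, hN⟩ := hB
  refine ⟨M ⊔ N, by simp [hMA, hNB], hM.sup hN ?_⟩
  rwa [hM.support_eq_verts, hN.support_eq_verts, hMA, hNB, disjoint_coe]

lemma Matchable.of_parts {A B U : Finset V} (hA : Matchable G A) (hB : Matchable G B)
    (hU : ∀ v, v ∈ U ↔ v ∈ A ∨ v ∈ B) (hd : ∀ v ∈ A, v ∉ B) : Matchable G U := by
  classical
  convert hA.union hB (Finset.disjoint_left.2 hd) using 1
  ext v
  rw [hU, mem_union]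

variable [DecidableEq V]

lemma matchable_pair {a b : V} (h : G.Adj a b) : Matchable G {a, b} :=
  ⟨G.subgraphOfAdj h, by simp, .subgraphOfAdj h⟩

lemma Matchable.biUnion {ι : Type*} {s : Finset ι} {t : ι → Finset V}
    (h : ∀ i ∈ s, Matchable G (t i)) (hd : (s : Set ι).PairwiseDisjoint t) :
    Matchable G (s.biUnion t) := by
  choose M hMt hM using fun i : s => h i i.2
  refine ⟨⨆ i, M i, by ext; simp [hMt], .iSup hM fun i j hij => ?_⟩
  change Disjoint (M i).support (M j).support
  rw [(hM i).support_eq_verts, (hM j).support_eq_verts, hMt, hMt, disjoint_coe]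
  exact hd i.2 j.2 (Subtype.coe_injective.ne hij)

lemma Matchable.exists_partner {x : V} {U : Finset V} (h : Matchable G U) (hx : x ∈ U) :
    ∃ u ∈ U, G.Adj x u ∧ Matchable G (U \ {x, u}) := by
  obtain ⟨M, hMU, hM⟩ := h
  obtain ⟨u, hxu, -⟩ := hM (show x ∈ M.verts by simpa [hMU] using hx)
  refine ⟨u, by simpa [hMU] using M.edge_vert hxu.symm, hxu.adj_sub, M.induce ↑(U \ {x, u}),
    by simp, isMatching_induce_of_closed hM (by simp [hMU]) fun a ha b hab => ?_⟩
  simp only [coe_sdiff, coe_insert, coe_singleton, Set.mem_sdiff, mem_coe, Set.mem_insert_iff,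
    Set.mem_singleton_iff, not_or] at ha ⊢
  refine ⟨by simpa [hMU] using M.edge_vert hab.symm, ?_, ?_⟩
  · rintro rfl
    exact ha.2.2 (hM.eq_of_adj_left hab.symm hxu)
  · rintro rfl
    exact ha.2.1 (hM.eq_of_adj_right hab hxu)

/-- The subgraph of `G` induced on `U` is factor-critical: it has a perfect matching after the
deletion of any one vertex. -/
def FactorCritical (G : SimpleGraph V) (U : Finset V) : Prop :=
  U.Nonempty ∧ ∀ v ∈ U, Matchable G (U.erase v)

lemma FactorCritical.odd_card {U : Finset V} (h : FactorCritical G U) : Odd U.card := by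
  obtain ⟨v, hv⟩ := h.1
  rw [← card_erase_add_one hv]
  exact (h.2 v hv).even_card.add_one

lemma FactorCritical.matchable_insert {K : Finset V} (h : FactorCritical G K) {x k : V}
    (hx : x ∉ K) (hk : k ∈ K) (hadj : G.Adj x k) : Matchable G (insert x K) := by
  have hdisj : Disjoint {x, k} (K.erase k) := by simp [hx]
  convert (matchable_pair hadj).union (h.2 k hk) hdisj using 1
  rw [insert_union, singleton_union, insert_erase hk]

end Matchable

/-! ### Barriers -/

section Barrier

variable {V : Type*} {G : SimpleGraph V}

/-- A barrier in `C`: a separator `S` together with a family `𝒦` of pairwise disjoint odd subsets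
of `C \ S`, each of which is joined within `C` only to itself and to `S`. The members of `𝒦` need
neither be connected nor exhaust `C \ S`. -/
structure Barrier (G : SimpleGraph V) (C S : Finset V) (𝒦 : Finset (Finset V)) : Prop where
  sep_subset : S ⊆ C
  subset : ∀ ⦃K⦄, K ∈ 𝒦 → K ⊆ C
  disjoint : ∀ ⦃K⦄, K ∈ 𝒦 → Disjoint K S
  odd_card : ∀ ⦃K⦄, K ∈ 𝒦 → Odd K.card
  pairwiseDisjoint : (𝒦 : Set (Finset V)).PairwiseDisjoint id
  mem_or_mem : ∀ ⦃K⦄, K ∈ 𝒦 → ∀ ⦃k⦄, k ∈ K → ∀ ⦃v⦄, v ∈ C → G.Adj k v → v ∈ K ∨ v ∈ S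

open Classical in
/-- The vertices of `S` adjacent to a member of `𝒦`. -/
noncomputable def nbr (G : SimpleGraph V) (S : Finset V) (𝒦 : Finset (Finset V)) : Finset V :=
  S.filter fun s => ∃ K ∈ 𝒦, ∃ k ∈ K, G.Adj s k

lemma mem_nbr {S : Finset V} {𝒦 : Finset (Finset V)} {s : V} :
    s ∈ nbr G S 𝒦 ↔ s ∈ S ∧ ∃ K ∈ 𝒦, ∃ k ∈ K, G.Adj s k := by
  simp [nbr]

lemma mem_nbr_singleton {S K : Finset V} {s : V} :
    s ∈ nbr G S {K} ↔ s ∈ S ∧ ∃ k ∈ K, G.Adj s k := by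
  simp [nbr]

lemma nbr_subset {S : Finset V} {𝒦 : Finset (Finset V)} : nbr G S 𝒦 ⊆ S :=
  fun _ hs => (mem_nbr.1 hs).1

lemma nbr_nbr {S : Finset V} {𝒦 𝒦' : Finset (Finset V)} (h : 𝒦' ⊆ 𝒦) :
    nbr G (nbr G S 𝒦) 𝒦' = nbr G S 𝒦' := by
  ext v
  simp only [mem_nbr]
  exact ⟨fun hv => ⟨hv.1.1, hv.2⟩, fun hv => ⟨⟨hv.1, hv.2.imp fun K hK => ⟨h hK.1, hK.2⟩⟩, hv.2⟩⟩

lemma barrier_empty {C : Finset V} : Barrier G C ∅ ∅ := by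
  constructor <;> simp

namespace Barrier

variable {C S : Finset V} {𝒦 : Finset (Finset V)} {K L : Finset V} {v : V}

lemma nonempty (h : Barrier G C S 𝒦) (hK : K ∈ 𝒦) : K.Nonempty :=
  card_pos.1 (h.odd_card hK).pos

lemma notMem (h : Barrier G C S 𝒦) (hK : K ∈ 𝒦) (hv : v ∈ K) : v ∉ S :=
  Finset.disjoint_left.1 (h.disjoint hK) hv

lemma eq_of_mem (h : Barrier G C S 𝒦) (hK : K ∈ 𝒦) (hL : L ∈ 𝒦) (hvK : v ∈ K) (hvL : v ∈ L) :
    K = L :=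
  h.pairwiseDisjoint.elim_finset hK hL v hvK hvL

lemma restrict (h : Barrier G C S 𝒦) {𝒦' : Finset (Finset V)} (h𝒦 : 𝒦' ⊆ 𝒦) :
    Barrier G C (nbr G S 𝒦') 𝒦' where
  sep_subset := nbr_subset.trans h.sep_subset
  subset _ hK := h.subset (h𝒦 hK)
  disjoint _ hK := (h.disjoint (h𝒦 hK)).mono_right nbr_subset
  odd_card _ hK := h.odd_card (h𝒦 hK)
  pairwiseDisjoint := h.pairwiseDisjoint.subset (coe_subset.2 h𝒦)
  mem_or_mem K hK k hk _ hv hadj := (h.mem_or_mem (h𝒦 hK) hk hv hadj).imp_right fun hs =>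
    mem_nbr.2 ⟨hs, K, hK, k, hk, hadj.symm⟩

lemma exists_injective (h : Barrier G C S 𝒦) {M : G.Subgraph} (hMC : M.verts = C)
    (hM : M.IsMatching) :
    ∃ φ : 𝒦 → S, Function.Injective φ ∧ ∀ K, ∃ k ∈ K.1, M.Adj k (φ K) := by
  have hcross : ∀ K : 𝒦, ∃ s : S, ∃ k ∈ K.1, M.Adj k s := by
    rintro ⟨K, hK⟩
    by_contra! hcon
    have hKM : Matchable G K := by
      refine ⟨M.induce K, rfl, isMatching_induce_of_closed hM ?_ fun k hk s hks => ?_⟩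
      · simpa [hMC] using h.subset hK
      · have hsC : s ∈ C := by simpa [hMC] using M.edge_vert hks.symm
        exact (h.mem_or_mem hK hk hsC hks.adj_sub).resolve_right fun hs => hcon ⟨s, hs⟩ k hk hks
    exact Nat.not_even_iff_odd.2 (h.odd_card hK) hKM.even_card
  choose φ k hk hφ using hcross
  refine ⟨φ, fun K L hKL => Subtype.ext (h.eq_of_mem K.2 L.2 (hk K) ?_), fun K => ⟨k K, hk K, hφ K⟩⟩
  rw [hM.eq_of_adj_right (hφ K) (hKL ▸ hφ L)]
  exact hk L

lemma card_le (h : Barrier G C S 𝒦) (hC : Matchable G C) : 𝒦.card ≤ S.card := by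
  obtain ⟨M, hMC, hM⟩ := hC
  obtain ⟨φ, hφ, -⟩ := h.exists_injective hMC hM
  simpa using Fintype.card_le_of_injective φ hφ

variable [DecidableEq V]

lemma insert_sep (h : Barrier G C S 𝒦) (hv : v ∈ C) (hv𝒦 : ∀ K ∈ 𝒦, v ∉ K) :
    Barrier G C (insert v S) 𝒦 where
  sep_subset := insert_subset hv h.sep_subset
  subset := h.subset
  disjoint K hK := disjoint_insert_right.2 ⟨hv𝒦 K hK, h.disjoint hK⟩
  odd_card := h.odd_card
  pairwiseDisjoint := h.pairwiseDisjoint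
  mem_or_mem _ hK _ hk _ hv hadj := (h.mem_or_mem hK hk hv hadj).imp_right mem_insert_of_mem

lemma union_sep {T : Finset V} (h : Barrier G (C \ T) S 𝒦) (hT : T ⊆ C) :
    Barrier G C (S ∪ T) 𝒦 where
  sep_subset := union_subset (h.sep_subset.trans sdiff_subset) hT
  subset _ hK := (h.subset hK).trans sdiff_subset
  disjoint _ hK := disjoint_union_right.2
    ⟨h.disjoint hK, disjoint_sdiff_self_left.mono_left (h.subset hK)⟩
  odd_card := h.odd_card
  pairwiseDisjoint := h.pairwiseDisjoint
  mem_or_mem K hK k hk v hv hadj := by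
    by_cases hvT : v ∈ T
    · exact Or.inr (mem_union_right _ hvT)
    · exact (h.mem_or_mem hK hk (mem_sdiff.2 ⟨hv, hvT⟩) hadj).imp_right (mem_union_left _)

lemma erase (h : Barrier G C S 𝒦) (hv : ∀ K ∈ 𝒦, v ∉ K) :
    Barrier G (C.erase v) (S.erase v) 𝒦 where
  sep_subset := erase_subset_erase v h.sep_subset
  subset K hK := subset_erase.2 ⟨h.subset hK, hv K hK⟩
  disjoint _ hK := (h.disjoint hK).mono_right (erase_subset _ _)
  odd_card := h.odd_card
  pairwiseDisjoint := h.pairwiseDisjoint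
  mem_or_mem _ hK _ hk _ hx hadj := (h.mem_or_mem hK hk (mem_of_mem_erase hx) hadj).imp_right
    fun hs => mem_erase.2 ⟨ne_of_mem_erase hx, hs⟩

/-- The vertices of the ambient set outside a barrier. -/
def rest (C S : Finset V) (𝒦 : Finset (Finset V)) : Finset V := C \ (S ∪ 𝒦.biUnion id)

lemma mem_rest : v ∈ rest C S 𝒦 ↔ v ∈ C ∧ v ∉ S ∧ ∀ K ∈ 𝒦, v ∉ K := by
  simp [rest]

lemma insert_rest (h : Barrier G C S 𝒦) (hodd : Odd (rest C S 𝒦).card) :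
    Barrier G C S (insert (rest C S 𝒦) 𝒦) where
  sep_subset := h.sep_subset
  subset := (forall_mem_insert _ _ _).2 ⟨sdiff_subset, h.subset⟩
  disjoint := (forall_mem_insert _ _ _).2
    ⟨Finset.disjoint_left.2 fun _ hv => (mem_rest.1 hv).2.1, h.disjoint⟩
  odd_card := (forall_mem_insert _ _ _).2 ⟨hodd, h.odd_card⟩
  pairwiseDisjoint := by
    rw [coe_insert]
    exact h.pairwiseDisjoint.insert fun L hL _ =>
      Finset.disjoint_left.2 fun v hv hvL => (mem_rest.1 hv).2.2 L hL hvL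
  mem_or_mem := (forall_mem_insert _ _ _).2 ⟨fun k hk v hv hadj => by
    by_contra! hnot
    obtain ⟨hkC, hkS, hk𝒦⟩ := mem_rest.1 hk
    refine hnot.1 (mem_rest.2 ⟨hv, hnot.2, fun K hK hvK => ?_⟩)
    exact (h.mem_or_mem hK hvK hkC hadj.symm).elim (hk𝒦 K hK) hkS, h.mem_or_mem⟩

lemma card_insert_rest (hodd : Odd (rest C S 𝒦).card) :
    (insert (rest C S 𝒦) 𝒦).card = 𝒦.card + 1 := by
  refine card_insert_of_notMem fun hmem => ?_
  obtain ⟨v, hv⟩ := card_pos.1 hodd.pos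
  exact (mem_rest.1 hv).2.2 _ hmem hv

lemma even_card_add (h : Barrier G C S 𝒦) :
    Even (C.card + S.card + 𝒦.card + (rest C S 𝒦).card) := by
  have hdisj : Disjoint S (𝒦.biUnion id) :=
    (disjoint_biUnion_right _ _ _).2 fun K hK => (h.disjoint hK).symm
  have hsub : S ∪ 𝒦.biUnion id ⊆ C := union_subset h.sep_subset (biUnion_subset.2 h.subset)
  have hcard : (rest C S 𝒦).card + (S.card + ∑ K ∈ 𝒦, K.card) = C.card := by
    rw [← card_sdiff_add_card_eq_card hsub, card_union_of_disjoint hdisj,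
      card_biUnion h.pairwiseDisjoint]
    rfl
  have hodd : Even (∑ K ∈ 𝒦, K.card + 𝒦.card) := by
    rw [card_eq_sum_ones 𝒦, ← sum_add_distrib]
    exact even_sum _ fun K hK => (h.odd_card hK).add_one
  grind

lemma exists_insert_sep (h : Barrier G C S 𝒦) (hv : v ∈ rest C S 𝒦)
    (heven : Even (rest C S 𝒦).card) :
    ∃ 𝒦', Barrier G C (insert v S) 𝒦' ∧ 𝒦'.card = 𝒦.card + 1 := by
  obtain ⟨hvC, hvS, hv𝒦⟩ := mem_rest.1 hv
  have hB := h.insert_sep hvC hv𝒦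
  have hodd : Odd (rest C (insert v S) 𝒦).card := by
    have h₁ := h.even_card_add
    have h₂ := hB.even_card_add
    rw [card_insert_of_notMem hvS] at h₂
    grind
  exact ⟨_, hB.insert_rest hodd, card_insert_rest hodd⟩

lemma refine (h : Barrier G C S 𝒦) (hK : K ∈ 𝒦) (hv : v ∈ K) {S' : Finset V}
    {𝒦' : Finset (Finset V)} (h' : Barrier G (K.erase v) S' 𝒦') :
    Barrier G C (insert v (S ∪ S')) (𝒦.erase K ∪ 𝒦') where
  sep_subset := insert_subset (h.subset hK hv) <| union_subset h.sep_subset <|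
    (h'.sep_subset.trans (erase_subset _ _)).trans (h.subset hK)
  subset L hL := by
    rcases mem_union.1 hL with hL | hL
    · exact h.subset (mem_of_mem_erase hL)
    · exact ((h'.subset hL).trans (erase_subset _ _)).trans (h.subset hK)
  disjoint L hL := by
    rw [disjoint_insert_right, disjoint_union_right]
    rcases mem_union.1 hL with hL | hL
    · obtain ⟨hne, hL⟩ := mem_erase.1 hL
      have hLK : Disjoint L K := h.pairwiseDisjoint hL hK hne
      exact ⟨fun hvL => Finset.disjoint_left.1 hLK hvL hv, h.disjoint hL,
        hLK.mono_right (h'.sep_subset.trans (erase_subset _ _))⟩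
    · exact ⟨fun hvL => notMem_erase v K (h'.subset hL hvL),
        (h.disjoint hK).mono_left ((h'.subset hL).trans (erase_subset _ _)), h'.disjoint hL⟩
  odd_card L hL := (mem_union.1 hL).elim (fun hL => h.odd_card (mem_of_mem_erase hL))
    fun hL => h'.odd_card hL
  pairwiseDisjoint := by
    rw [coe_union, Set.pairwiseDisjoint_union]
    refine ⟨h.pairwiseDisjoint.subset (coe_subset.2 (erase_subset _ _)), h'.pairwiseDisjoint,
      fun L hL M hM _ => ?_⟩
    obtain ⟨hne, hL⟩ := mem_erase.1 (mem_coe.1 hL)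
    exact (h.pairwiseDisjoint hL hK hne).mono_right
      ((h'.subset hM).trans (erase_subset _ _))
  mem_or_mem L hL l hl x hx hadj := by
    simp only [mem_insert, mem_union]
    rcases mem_union.1 hL with hL | hL
    · exact (h.mem_or_mem (mem_of_mem_erase hL) hl hx hadj).imp_right fun hxS => .inr (.inl hxS)
    · by_cases hxv : x = v
      · exact Or.inr (Or.inl hxv)
      rcases h.mem_or_mem hK (mem_of_mem_erase (h'.subset hL hl)) hx hadj with hxK | hxS
      · exact (h'.mem_or_mem hL hl (mem_erase.2 ⟨hxv, hxK⟩) hadj).imp_right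
          fun hxS => .inr (.inr hxS)
      · exact Or.inr (Or.inr (Or.inl hxS))

lemma card_sep_refine (h : Barrier G C S 𝒦) (hK : K ∈ 𝒦) (hv : v ∈ K) {S' : Finset V}
    (hS' : S' ⊆ K.erase v) : (insert v (S ∪ S')).card = S.card + S'.card + 1 := by
  have hdisj : Disjoint S S' := ((h.disjoint hK).mono_left (hS'.trans (erase_subset _ _))).symm
  rw [card_insert_of_notMem, card_union_of_disjoint hdisj]
  exact fun hmem => (mem_union.1 hmem).elim (h.notMem hK hv) fun hvS' => notMem_erase v K (hS' hvS')

lemma card_refine (h : Barrier G C S 𝒦) (hK : K ∈ 𝒦) {S' : Finset V} {𝒦' : Finset (Finset V)}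
    (h' : Barrier G (K.erase v) S' 𝒦') : (𝒦.erase K ∪ 𝒦').card + 1 = 𝒦.card + 𝒦'.card := by
  rw [card_union_of_disjoint, ← card_erase_add_one hK]
  · omega
  · rw [Finset.disjoint_left]
    intro L hL hL'
    obtain ⟨hne, hL⟩ := mem_erase.1 hL
    obtain ⟨x, hx⟩ := h'.nonempty hL'
    exact hne (h.eq_of_mem hL hK hx (mem_of_mem_erase (h'.subset hL' hx)))

lemma matchable_of_card_le (h : Barrier G C S 𝒦) (hC : Matchable G C) (hcard : S.card ≤ 𝒦.card) :
    (∀ K ∈ 𝒦, ∃ s ∈ S, Matchable G (insert s K)) ∧ Matchable G (rest C S 𝒦) := by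
  have hcard' : Fintype.card 𝒦 = Fintype.card S := by simpa using (h.card_le hC).antisymm hcard
  obtain ⟨M, hMC, hM⟩ := hC
  obtain ⟨φ, hφinj, hφ⟩ := h.exists_injective hMC hM
  have hφsurj := ((Fintype.bijective_iff_injective_and_card φ).2 ⟨hφinj, hcard'⟩).surjective
  have hmemC : ∀ {a b}, M.Adj a b → a ∈ C := fun hab => by simpa [hMC] using M.edge_vert hab
  have hsep : ∀ (K : 𝒦) (a), M.Adj (φ K) a → a ∈ K.1 := by
    intro K a ha
    obtain ⟨k, hk, hkφ⟩ := hφ K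
    rwa [hM.eq_of_adj_left ha hkφ.symm]
  have hmember : ∀ (K : 𝒦), ∀ k ∈ K.1, ∀ a, M.Adj k a → a ∈ K.1 ∨ a = φ K := by
    intro K k hk a hka
    refine (h.mem_or_mem K.2 hk (hmemC hka.symm) hka.adj_sub).imp_right fun ha => ?_
    obtain ⟨L, hL⟩ := hφsurj ⟨a, ha⟩
    have hkL : k ∈ L.1 := hsep L k (by simpa [hL] using hka.symm)
    rw [Subtype.ext (h.eq_of_mem K.2 L.2 hk hkL), hL]
  constructor
  · intro K hK
    refine ⟨φ ⟨K, hK⟩, (φ _).2, M.induce ↑(insert (φ ⟨K, hK⟩ : V) K), rfl,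
      isMatching_induce_of_closed hM ?_ fun a ha b hab => ?_⟩
    · rw [hMC, coe_subset]
      exact insert_subset (h.sep_subset (φ _).2) (h.subset hK)
    · rw [mem_coe, mem_insert] at ha ⊢
      rcases ha with rfl | ha
      · exact Or.inr (hsep _ b hab)
      · exact (hmember ⟨K, hK⟩ a ha b hab).symm
  · refine ⟨M.induce ↑(rest C S 𝒦), rfl, isMatching_induce_of_closed hM ?_ fun a ha b hab => ?_⟩
    · simp [hMC, rest]
    · obtain ⟨-, haS, ha𝒦⟩ := mem_rest.1 (mem_coe.1 ha)
      refine mem_coe.2 (mem_rest.2 ⟨hmemC hab.symm, fun hb => ?_, fun K hK hb => ?_⟩)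
      · obtain ⟨K, hK⟩ := hφsurj ⟨b, hb⟩
        exact ha𝒦 K K.2 (hsep K a (by simpa [hK] using hab.symm))
      · exact (hmember ⟨K, hK⟩ b hb a hab.symm).elim (ha𝒦 K hK) fun h => haS (h ▸ (φ _).2)

end Barrier

lemma nbr_sdiff [DecidableEq V] {S T : Finset V} {𝒦 : Finset (Finset V)} :
    nbr G (S \ T) 𝒦 = nbr G S 𝒦 \ T := by
  ext v
  simp only [mem_nbr, mem_sdiff]
  tauto

end Barrier

section Tutte

variable {V W : Type*} {G : SimpleGraph V} {H : SimpleGraph W}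

lemma Barrier.map {C S : Finset W} {𝒦 : Finset (Finset W)} (h : Barrier H C S 𝒦) (f : H ↪g G) :
    Barrier G (C.map f.toEmbedding) (S.map f.toEmbedding)
      (𝒦.map (mapEmbedding f.toEmbedding).toEmbedding) where
  sep_subset := map_subset_map.2 h.sep_subset
  subset := by simpa using h.subset
  disjoint := by simpa [disjoint_map] using h.disjoint
  odd_card := by simpa using h.odd_card
  pairwiseDisjoint := by
    intro A hA B hB hne
    obtain ⟨K, hK, rfl⟩ := mem_map.1 hA
    obtain ⟨L, hL, rfl⟩ := mem_map.1 hB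
    exact (disjoint_map _).2 (h.pairwiseDisjoint hK hL (ne_of_apply_ne _ hne))
  mem_or_mem := by simpa using h.mem_or_mem

lemma exists_barrier_of_isTutteViolator [Fintype W] {T : Set W} (hT : H.IsTutteViolator T) :
    ∃ S 𝒦, Barrier H univ S 𝒦 ∧ S.card < 𝒦.card := by
  classical
  set D := (⊤ : H.Subgraph).deleteVerts T
  let supp (c : D.coe.ConnectedComponent) : Finset W := c.supp.toFinset.map (.subtype _)
  have hsupp : ∀ {c w}, w ∈ supp c ↔
      ∃ hw : w ∈ D.verts, D.coe.connectedComponentMk ⟨w, hw⟩ = c := by simp [supp]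
  have hinj : ∀ {c c' w}, w ∈ supp c → w ∈ supp c' → c = c' := by
    intro c c' w hc hc'
    obtain ⟨_, rfl⟩ := hsupp.1 hc
    obtain ⟨_, rfl⟩ := hsupp.1 hc'
    rfl
  refine ⟨T.toFinset, D.coe.oddComponents.toFinset.image supp, ?_, ?_⟩
  · constructor
    · exact subset_univ _
    · exact fun _ _ => subset_univ _
    · simp only [forall_mem_image, Finset.disjoint_left, hsupp, Set.mem_toFinset]
      rintro c - w ⟨hw, -⟩
      exact hw.2
    · simp [supp, Set.ncard_eq_toFinset_card']
    · intro A hA B hB hne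
      obtain ⟨c, -, rfl⟩ := mem_image.1 hA
      obtain ⟨c', -, rfl⟩ := mem_image.1 hB
      exact Finset.disjoint_left.2 fun w hc hc' => hne (congrArg supp (hinj hc hc'))
    · simp only [forall_mem_image, hsupp, Set.mem_toFinset]
      rintro c - v ⟨hv, rfl⟩ w - hvw
      by_cases hwT : w ∈ T
      · exact .inr hwT
      refine .inl ⟨⟨trivial, hwT⟩, ConnectedComponent.sound (Adj.reachable ?_)⟩
      simpa [D] using ⟨hwT, hv.2, hvw.symm⟩
  · rw [card_image_of_injective]
    · simpa [SimpleGraph.IsTutteViolator, Set.ncard_eq_toFinset_card'] using hT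
    · intro c c' h
      obtain ⟨⟨w, hw⟩, rfl⟩ := c.exists_rep
      have hwc : w ∈ supp (D.coe.connectedComponentMk ⟨w, hw⟩) := hsupp.2 ⟨hw, rfl⟩
      exact hinj hwc (h ▸ hwc)

lemma exists_barrier_card_lt_of_not_matchable {U : Finset V} (hU : ¬ Matchable G U) :
    ∃ S 𝒦, Barrier G U S 𝒦 ∧ S.card < 𝒦.card := by
  obtain ⟨T, hT⟩ : ∃ T : Set (U : Set V), (G.induce (U : Set V)).IsTutteViolator T := by
    by_contra! hno
    obtain ⟨M, hM⟩ := SimpleGraph.tutte.2 hno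
    refine hU ⟨_, ?_, hM.1.map (Embedding.induce (G := G) (U : Set V)).toHom Subtype.val_injective⟩
    ext
    simp [hM.2.verts_eq_univ]
  obtain ⟨S, 𝒦, hB, hlt⟩ := exists_barrier_of_isTutteViolator hT
  have hU : univ.map (Embedding.induce (G := G) (U : Set V)).toEmbedding = U := by ext; simp
  have hB' := hB.map (Embedding.induce (G := G) (U : Set V))
  rw [hU] at hB'
  exact ⟨_, _, hB', by simpa using hlt⟩

lemma exists_barrier_of_not_matchable {U : Finset V} (heven : Even U.card) (hU : ¬ Matchable G U) :
    ∃ S 𝒦, Barrier G U S 𝒦 ∧ S.card + 2 ≤ 𝒦.card := by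
  classical
  obtain ⟨S, 𝒦, hB, hlt⟩ := exists_barrier_card_lt_of_not_matchable hU
  have hpar := hB.even_card_add
  rcases Nat.even_or_odd (Barrier.rest U S 𝒦).card with hrest | hrest
  · exact ⟨S, 𝒦, hB, by grind⟩
  · exact ⟨S, _, hB.insert_rest hrest, by rw [Barrier.card_insert_rest hrest]; omega⟩

end Tutte

/-! ### Barriers in factor-critical sets -/

section FactorCritical

variable {V : Type*} {G : SimpleGraph V} {C S : Finset V}
  {𝒦 : Finset (Finset V)} {K : Finset V} {v : V}

lemma biUnion_nbr_singleton [DecidableEq V] (s : Finset 𝒦) :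
    s.biUnion (fun K => nbr G S {K.1}) = nbr G S (s.map (.subtype _)) := by
  ext v
  simp only [mem_biUnion, mem_nbr, mem_map, Function.Embedding.subtype_apply]
  grind

lemma exists_injective_mem_nbr_of_hall
    (hall : ∀ 𝒦' ⊆ 𝒦, 𝒦'.card ≤ (nbr G S 𝒦').card) :
    ∃ φ : 𝒦 → V, Function.Injective φ ∧ ∀ K, φ K ∈ nbr G S {K.1} := by
  classical
  refine (all_card_le_biUnion_card_iff_exists_injective fun K : 𝒦 => nbr G S {K.1}).1 fun s => ?_
  rw [biUnion_nbr_singleton, ← card_map (.subtype _)]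
  exact hall _ fun _ => property_of_mem_map_subtype s

variable [DecidableEq V]

lemma Barrier.exists_refine_of_not_factorCritical (h : Barrier G C S 𝒦) (hK : K ∈ 𝒦)
    (hnot : ¬ FactorCritical G K) :
    ∃ S' 𝒦', Barrier G C S' 𝒦' ∧ S ⊆ S' ∧ S.card < S'.card ∧
      S'.card + 𝒦.card ≤ 𝒦'.card + S.card ∧
      S' ∪ 𝒦'.biUnion id ⊆ S ∪ 𝒦.biUnion id ∧ ∀ L ∈ 𝒦', ∃ L₀ ∈ 𝒦, L ⊆ L₀ := by
  obtain ⟨k, hk, hnm⟩ : ∃ k ∈ K, ¬ Matchable G (K.erase k) := by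
    by_contra! hall
    exact hnot ⟨h.nonempty hK, hall⟩
  have heven : Even (K.erase k).card := by
    have := h.odd_card hK
    rw [← card_erase_add_one hk] at this
    grind
  obtain ⟨S₀, 𝒦₀, h₀, hcard₀⟩ := exists_barrier_of_not_matchable heven hnm
  have hsep := h.card_sep_refine hK hk h₀.sep_subset
  have hmem := h.card_refine hK h₀
  refine ⟨_, _, h.refine hK hk h₀, subset_union_left.trans (subset_insert _ _), by omega, by omega,
    ?_, ?_⟩
  · intro z hz
    have hS₀ : ∀ s ∈ S₀, s ∈ K := fun s hs => mem_of_mem_erase (h₀.sep_subset hs)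
    have h𝒦₀ : ∀ L ∈ 𝒦₀, ∀ l ∈ L, l ∈ K := fun L hL l hl => mem_of_mem_erase (h₀.subset hL hl)
    simp only [mem_union, mem_insert, mem_biUnion, id, mem_erase] at hz ⊢
    grind
  · intro L hL
    rcases mem_union.1 hL with hL | hL
    · exact ⟨L, mem_of_mem_erase hL, subset_rfl⟩
    · exact ⟨K, hK, (h₀.subset hL).trans (erase_subset _ _)⟩

namespace FactorCritical

lemma card_le_card_erase (hC : FactorCritical G C) (h : Barrier G C S 𝒦) (hvC : v ∈ C)
    (hv : ∀ K ∈ 𝒦, v ∉ K) : 𝒦.card ≤ (S.erase v).card :=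
  (h.erase hv).card_le (hC.2 v hvC)

lemma card_lt_card (hC : FactorCritical G C) (h : Barrier G C S 𝒦) (hS : S.Nonempty) :
    𝒦.card < S.card := by
  obtain ⟨s, hs⟩ := hS
  exact (hC.card_le_card_erase h (h.sep_subset hs) fun K hK hsK => h.notMem hK hsK hs).trans_lt
    (card_erase_lt_of_mem hs)

lemma card_lt_card_nbr (hC : FactorCritical G C) (h : Barrier G C S 𝒦) (hS : S.Nonempty)
    {𝒦' : Finset (Finset V)} (h𝒦 : 𝒦' ⊆ 𝒦) (hne : 𝒦'.Nonempty) :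
    𝒦'.card < (nbr G S 𝒦').card := by
  obtain ⟨s, hs⟩ := hS
  refine hC.card_lt_card (h.restrict h𝒦) (card_pos.1 ?_)
  calc 0 < 𝒦'.card := hne.card_pos
    _ ≤ ((nbr G S 𝒦').erase s).card := hC.card_le_card_erase (h.restrict h𝒦) (h.sep_subset hs)
        fun K hK hsK => h.notMem (h𝒦 hK) hsK hs
    _ ≤ (nbr G S 𝒦').card := card_erase_le

lemma matchable_rest (hC : FactorCritical G C) (h : Barrier G C S 𝒦) (hS : S.Nonempty)
    (hcard : S.card ≤ 𝒦.card + 1) : Matchable G (Barrier.rest C S 𝒦) := by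
  obtain ⟨s, hs⟩ := hS
  have herase := h.erase (v := s) fun K hK hsK => h.notMem hK hsK hs
  have hle : (S.erase s).card ≤ 𝒦.card := by rw [card_erase_of_mem hs]; omega
  refine (herase.matchable_of_card_le (hC.2 s (h.sep_subset hs)) hle).2.congr fun v => ?_
  simp only [Barrier.mem_rest, mem_erase]
  grind

end FactorCritical

lemma matchable_union_biUnion_of_hall (hFC : ∀ K ∈ 𝒦, FactorCritical G K)
    (hpair : (𝒦 : Set (Finset V)).PairwiseDisjoint id) (hdisj : ∀ K ∈ 𝒦, Disjoint K S)
    (hcard : S.card ≤ 𝒦.card) (hall : ∀ 𝒦' ⊆ 𝒦, 𝒦'.card ≤ (nbr G S 𝒦').card) :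
    Matchable G (S ∪ 𝒦.biUnion id) := by
  obtain ⟨φ, hφinj, hφ⟩ := exists_injective_mem_nbr_of_hall hall
  have hφS : ∀ K, φ K ∈ S := fun K => nbr_subset (hφ K)
  have himage : 𝒦.attach.image φ = S := by
    refine eq_of_subset_of_card_le (image_subset_iff.2 fun K _ => hφS K) ?_
    rwa [card_image_of_injective _ hφinj, card_attach]
  have hnotMem : ∀ K ∈ 𝒦, ∀ k ∈ K, k ∉ S := fun K hK _ hk =>
    Finset.disjoint_left.1 (hdisj K hK) hk
  have hkey : Matchable G (𝒦.attach.biUnion fun K => insert (φ K) K.1) := by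
    refine Matchable.biUnion (fun K _ => ?_) fun K _ L _ hne => ?_
    · obtain ⟨hs, k, hk, hadj⟩ := mem_nbr_singleton.1 (hφ K)
      exact (hFC K K.2).matchable_insert (fun hmem => hnotMem K K.2 _ hmem hs) hk hadj
    · have hKL : Disjoint K.1 L.1 := hpair K.2 L.2 (Subtype.coe_injective.ne hne)
      simp only [Function.onFun, disjoint_insert_left, disjoint_insert_right, mem_insert, not_or]
      exact ⟨⟨hφinj.ne hne.symm, fun hL => hnotMem K K.2 _ hL (hφS L)⟩,
        fun hK => hnotMem L L.2 _ hK (hφS K), hKL⟩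
  refine hkey.congr fun v => ?_
  simp only [← himage, mem_union, mem_image, mem_biUnion, mem_attach, true_and, mem_insert, id,
    Subtype.exists]
  grind

lemma Barrier.matchable_sdiff_pair_union (h : Barrier G C S 𝒦)
    (hFC : ∀ K ∈ 𝒦, FactorCritical G K) (hcard : S.card ≤ 𝒦.card + 1) (hK : K ∈ 𝒦) {x x' : V}
    (hx : x ∈ S) (hx' : x' ∈ S) (hne : x ≠ x')
    (hall : ∀ 𝒦' ⊆ 𝒦.erase K, 𝒦'.Nonempty → 𝒦'.card ≤ (nbr G S 𝒦' \ {x, x'}).card) :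
    Matchable G (S \ {x, x'} ∪ (𝒦.erase K).biUnion id) := by
  refine matchable_union_biUnion_of_hall (fun L hL => hFC L (mem_of_mem_erase hL))
    (h.pairwiseDisjoint.subset (by simp))
    (fun L hL => (h.disjoint (mem_of_mem_erase hL)).mono_right sdiff_subset) ?_ ?_
  · rw [card_sdiff_of_subset (by grind), card_pair hne, card_erase_of_mem hK]
    omega
  · intro 𝒦' h𝒦'
    rcases 𝒦'.eq_empty_or_nonempty with rfl | hne'
    · simp
    · rw [nbr_sdiff]
      exact hall 𝒦' h𝒦' hne'

end FactorCritical

/-! ### Ends -/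

section End

variable {V : Type*} [DecidableEq V] {G : SimpleGraph V}

/-- An end of `C` with attachment set `X`: a factor-critical set `K` joined to the rest of `C` only
through `X`, such that `C \ K` is matchable, also after the deletion of any two vertices of `X`. -/
structure IsEnd (G : SimpleGraph V) (C K X : Finset V) : Prop where
  subset : K ⊆ C
  attachment_subset : X ⊆ C
  notMem : ∀ x ∈ X, x ∉ K
  factorCritical : FactorCritical G K
  mem_or_mem : ∀ k ∈ K, ∀ v ∈ C, G.Adj k v → v ∈ K ∨ v ∈ X
  matchable : Matchable G (C \ K)
  matchable_pair : ∀ x ∈ X, ∀ x' ∈ X, x ≠ x' → Matchable G ((C \ K) \ {x, x'})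

/-- A barrier with factor-critical members whose separator has exactly one vertex more than there
are members, whereas every proper nonempty subfamily has at least two neighbors more than
members. -/
structure TightBarrier (G : SimpleGraph V) (C X : Finset V) (𝒵 : Finset (Finset V)) : Prop
    extends Barrier G C X 𝒵 where
  factorCritical : ∀ ⦃K⦄, K ∈ 𝒵 → FactorCritical G K
  card_sep : X.card = 𝒵.card + 1
  card_add_two_le : ∀ 𝒵' ⊆ 𝒵, 𝒵' ≠ 𝒵 → 𝒵'.Nonempty → 𝒵'.card + 2 ≤ (nbr G X 𝒵').card

namespace TightBarrier

variable {C X : Finset V} {𝒵 : Finset (Finset V)} {K : Finset V} {w x x' : V}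

lemma sep_nonempty (h : TightBarrier G C X 𝒵) : X.Nonempty :=
  card_pos.1 (by rw [h.card_sep]; omega)

lemma matchable_union (h : TightBarrier G C X 𝒵) (hK : K ∈ 𝒵) (hx : x ∈ X) (hx' : x' ∈ X)
    (hne : x ≠ x') : Matchable G (X \ {x, x'} ∪ (𝒵.erase K).biUnion id) := by
  refine h.matchable_sdiff_pair_union h.factorCritical h.card_sep.le hK hx hx' hne
    fun 𝒵' h𝒵' hne' => ?_
  have hneK : 𝒵' ≠ 𝒵 := fun h => notMem_erase K 𝒵 (h𝒵' (h ▸ hK))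
  have hnbr := h.card_add_two_le 𝒵' (h𝒵'.trans (erase_subset _ _)) hneK hne'
  have hsdiff := le_card_sdiff {x, x'} (nbr G X 𝒵')
  have htwo := card_le_two (a := x) (b := x')
  omega

lemma matchable_of_rest (h : TightBarrier G C X 𝒵) (hK : K ∈ 𝒵) (hx : x ∈ X) (hx' : x' ∈ X)
    (hne : x ≠ x') {R U : Finset V} (hR : Matchable G R)
    (hRmem : ∀ r ∈ R, r = x' ∨ r ∈ Barrier.rest C X 𝒵)
    (hU : ∀ v, v ∈ U ↔ v ∈ C ∧ v ∉ K ∧ v ≠ x ∧ (v = x' ∨ v ∈ Barrier.rest C X 𝒵 → v ∈ R)) :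
    Matchable G U := by
  have hXC := h.sep_subset
  have hsub := h.subset
  have hnot := fun L hL v => h.notMem (K := L) (v := v) hL
  have heq := fun L hL v => h.eq_of_mem (L := L) (v := v) hK hL
  refine (h.matchable_union hK hx hx' hne).of_parts hR (fun v => ?_) fun v hv hvR => ?_
  · have hvR := hRmem v
    simp only [hU, mem_union, mem_sdiff, mem_insert, mem_singleton, mem_biUnion, mem_erase, id,
      Barrier.mem_rest] at hvR ⊢
    grind
  · have hvR := hRmem v hvR
    simp only [mem_union, mem_sdiff, mem_insert, mem_singleton, mem_biUnion, mem_erase, id,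
      Barrier.mem_rest] at hv hvR
    grind

lemma matchable_sdiff_pair (h : TightBarrier G C X 𝒵) (hC : FactorCritical G C) (hK : K ∈ 𝒵)
    (hx : x ∈ X) (hx' : x' ∈ X) (hne : x ≠ x') : Matchable G ((C \ K) \ {x, x'}) := by
  have hrest := hC.matchable_rest h.toBarrier h.sep_nonempty h.card_sep.le
  refine h.matchable_of_rest hK hx hx' hne hrest (fun _ => .inr) fun v => ?_
  simp only [mem_sdiff, mem_insert, mem_singleton, Barrier.mem_rest]
  grind

lemma isEnd (h : TightBarrier G C X 𝒵) (hC : FactorCritical G C) (hK : K ∈ 𝒵)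
    (hCK : Matchable G (C \ K)) : IsEnd G C K X where
  subset := h.subset hK
  attachment_subset := h.sep_subset
  notMem _ hx hxK := h.notMem hK hxK hx
  factorCritical := h.factorCritical hK
  mem_or_mem _ hk _ hv hadj := h.mem_or_mem hK hk hv hadj
  matchable := hCK
  matchable_pair _ hx _ hx' hne := h.matchable_sdiff_pair hC hK hx hx' hne

lemma three_le_card_nbr (h : TightBarrier G C X 𝒵) (hK : K ∈ 𝒵) (h𝒵 : 𝒵 ≠ {K}) :
    3 ≤ (nbr G X {K}).card := by
  simpa using h.card_add_two_le {K} (singleton_subset_iff.2 hK) h𝒵.symm (singleton_nonempty K)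

/-- If `w` lies in the rest of the barrier, deleting it makes the rest odd; a matching of `C \ w`
then joins that odd set to the separator at a vertex `g`. -/
lemma exists_matchable_insert (h : TightBarrier G C X 𝒵) (hC : FactorCritical G C)
    (hw : w ∈ Barrier.rest C X 𝒵) :
    ∃ g ∈ X, Matchable G (insert g ((Barrier.rest C X 𝒵).erase w)) := by
  obtain ⟨hwC, hwX, hw𝒵⟩ := Barrier.mem_rest.1 hw
  have hB := h.erase hw𝒵
  rw [erase_eq_of_notMem hwX] at hB
  have hrest : Barrier.rest (C.erase w) X 𝒵 = (Barrier.rest C X 𝒵).erase w := by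
    rw [Barrier.rest, erase_sdiff_comm, Barrier.rest]
  have heven := (hC.matchable_rest h.toBarrier h.sep_nonempty h.card_sep.le).even_card
  have hodd : Odd (Barrier.rest (C.erase w) X 𝒵).card := by
    rw [← card_erase_add_one hw] at heven
    rw [hrest]
    grind
  rw [← hrest]
  refine ((hB.insert_rest hodd).matchable_of_card_le (hC.2 w hwC) ?_).1 _ (mem_insert_self _ _)
  rw [Barrier.card_insert_rest hodd, h.card_sep]

lemma exists_gate (h : TightBarrier G C X 𝒵) (hC : FactorCritical G C) (hw : w ∈ C)
    (hw𝒵 : ∀ K ∈ 𝒵, w ∉ K) :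
    ∃ g ∈ X, ∀ x ∈ X, x ≠ g → ∀ K ∈ 𝒵, Matchable G ((C \ K) \ {w, x}) := by
  by_cases hwX : w ∈ X
  · exact ⟨w, hwX, fun x hx hxw K hK => h.matchable_sdiff_pair hC hK hwX hx hxw.symm⟩
  have hwR : w ∈ Barrier.rest C X 𝒵 := Barrier.mem_rest.2 ⟨hw, hwX, hw𝒵⟩
  obtain ⟨g, hg, hgm⟩ := h.exists_matchable_insert hC hwR
  refine ⟨g, hg, fun x hx hxg K hK => h.matchable_of_rest hK hx hg hxg hgm ?_ fun v => ?_⟩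
  · grind
  · simp only [mem_sdiff, mem_insert, mem_singleton, mem_erase]
    grind

end TightBarrier

/-- A barrier that separates the edge `u v`, which is in the separator, from the vertex `w`, which
is in no member. -/
structure SplittingBarrier (G : SimpleGraph V) (C : Finset V) (u v w : V) (S : Finset V)
    (𝒦 : Finset (Finset V)) : Prop extends Barrier G C S 𝒦 where
  left_mem : u ∈ S
  right_mem : v ∈ S
  notMem_member : ∀ K ∈ 𝒦, w ∉ K
  card_sep_le : S.card ≤ 𝒦.card + 1

lemma exists_splittingBarrier {C : Finset V} (hC : FactorCritical G C) {u v w : V} (hu : u ∈ C)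
    (hv : v ∈ C) (hw : w ∈ C) (huv : u ≠ v) (huw : u ≠ w) (hvw : v ≠ w)
    (hflat : ¬ Matchable G (C \ {u, v, w})) : ∃ S 𝒦, SplittingBarrier G C u v w S 𝒦 := by
  have hsub : ({u, v, w} : Finset V) ⊆ C := by grind
  have hthree : ({u, v, w} : Finset V).card = 3 := card_eq_three.2 ⟨u, v, w, huv, huw, hvw, rfl⟩
  have heven : Even (C \ {u, v, w}).card := by
    have hodd := hC.odd_card
    rw [← card_sdiff_add_card_eq_card hsub, hthree] at hodd
    grind
  obtain ⟨S, 𝒦, hB, hcard⟩ := exists_barrier_of_not_matchable heven hflat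
  refine ⟨S ∪ {u, v, w}, 𝒦, hB.union_sep hsub, by simp, by simp, fun K hK hwK => ?_, ?_⟩
  · simpa using hB.subset hK hwK
  · have := card_union_le S {u, v, w}
    omega

/-- A splitting barrier that covers an inclusion-minimal set of vertices and, subject to this, has
the largest possible separator. -/
structure MinimalSplittingBarrier (G : SimpleGraph V) (C : Finset V) (u v w : V) (S : Finset V)
    (𝒦 : Finset (Finset V)) : Prop extends SplittingBarrier G C u v w S 𝒦 where
  minimal : ∀ ⦃S' 𝒦'⦄, SplittingBarrier G C u v w S' 𝒦' →
    S' ∪ 𝒦'.biUnion id ⊆ S ∪ 𝒦.biUnion id →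
      S ∪ 𝒦.biUnion id ⊆ S' ∪ 𝒦'.biUnion id ∧ S'.card ≤ S.card

lemma SplittingBarrier.exists_minimal {C S₀ : Finset V} {𝒦₀ : Finset (Finset V)} {u v w : V}
    (h₀ : SplittingBarrier G C u v w S₀ 𝒦₀) : ∃ S 𝒦, MinimalSplittingBarrier G C u v w S 𝒦 := by
  obtain ⟨⟨S, 𝒦⟩, h, hmin⟩ := exists_minimalFor_of_wellFoundedLT
    (fun p : Finset V × Finset (Finset V) => SplittingBarrier G C u v w p.1 p.2)
    (fun p => toLex ((p.1 ∪ p.2.biUnion id).card, C.card - p.1.card)) ⟨(S₀, 𝒦₀), h₀⟩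
  refine ⟨S, 𝒦, h, fun S' 𝒦' h' hsub => ?_⟩
  have hmin' := hmin (j := (S', 𝒦')) h'
  simp only [Prod.Lex.toLex_le_toLex] at hmin'
  have hle := card_le_card hsub
  have hS' := card_le_card h'.sep_subset
  by_cases hcard : (S ∪ 𝒦.biUnion id).card ≤ (S' ∪ 𝒦'.biUnion id).card
  · exact ⟨(eq_of_subset_of_card_le hsub hcard).ge, by omega⟩
  · omega

namespace MinimalSplittingBarrier

variable {C S : Finset V} {𝒦 : Finset (Finset V)} {K : Finset V} {u v w : V}

lemma factorCritical (h : MinimalSplittingBarrier G C u v w S 𝒦) (hK : K ∈ 𝒦) :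
    FactorCritical G K := by
  by_contra hnot
  obtain ⟨S', 𝒦', hB, hSS', hlt, hcard, hcover, hmem⟩ :=
    h.exists_refine_of_not_factorCritical hK hnot
  have h' : SplittingBarrier G C u v w S' 𝒦' := by
    refine ⟨hB, hSS' h.left_mem, hSS' h.right_mem, fun L hL hwL => ?_, ?_⟩
    · obtain ⟨L₀, hL₀, hLL₀⟩ := hmem L hL
      exact h.notMem_member L₀ hL₀ (hLL₀ hwL)
    · have := h.card_sep_le
      omega
  exact hlt.not_ge (h.minimal h' hcover).2

lemma card_add_two_le (h : MinimalSplittingBarrier G C u v w S 𝒦) (hK : K ∈ 𝒦)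
    {𝒦' : Finset (Finset V)} (h𝒦' : 𝒦' ⊆ 𝒦.erase K) (hu : u ∈ nbr G S 𝒦')
    (hv : v ∈ nbr G S 𝒦') : 𝒦'.card + 2 ≤ (nbr G S 𝒦').card := by
  by_contra! hlt
  have hsub := h𝒦'.trans (erase_subset _ _)
  have h' : SplittingBarrier G C u v w (nbr G S 𝒦') 𝒦' :=
    ⟨h.restrict hsub, hu, hv, fun L hL => h.notMem_member L (hsub hL), by omega⟩
  have hcover := (h.minimal h' <|
    union_subset_union nbr_subset (biUnion_subset_biUnion_of_subset_left _ hsub)).1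
  obtain ⟨k, hk⟩ := h.nonempty hK
  rcases mem_union.1 (hcover (mem_union_right _ (mem_biUnion.2 ⟨K, hK, hk⟩))) with hkS | hk𝒦'
  · exact h.notMem hK hk (nbr_subset hkS)
  · obtain ⟨L, hL, hkL⟩ := mem_biUnion.1 hk𝒦'
    exact notMem_erase K 𝒦 (h𝒦' (h.eq_of_mem (hsub hL) hK hkL hk ▸ hL))

lemma matchable_sdiff (h : MinimalSplittingBarrier G C u v w S 𝒦) (hC : FactorCritical G C)
    (huv : G.Adj u v) (hK : K ∈ 𝒦) : Matchable G (C \ K) := by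
  have hS : S.Nonempty := ⟨u, h.left_mem⟩
  have hunion := h.matchable_sdiff_pair_union (fun _ => h.factorCritical) h.card_sep_le hK
    h.left_mem h.right_mem huv.ne fun 𝒦' h𝒦' hne => by
      have hsdiff := le_card_sdiff {u, v} (nbr G S 𝒦')
      by_cases huv' : u ∈ nbr G S 𝒦' ∧ v ∈ nbr G S 𝒦'
      · have := h.card_add_two_le hK h𝒦' huv'.1 huv'.2
        have := card_le_two (a := u) (b := v)
        omega
      · have hlt := hC.card_lt_card_nbr h.toBarrier hS (h𝒦'.trans (erase_subset _ _)) hne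
        have : (nbr G S 𝒦' ∩ {u, v}).card < 2 := by
          rw [← card_pair huv.ne]
          exact card_lt_card ⟨inter_subset_right, fun hsub => huv' (by grind)⟩
        have := card_sdiff_add_card_inter (nbr G S 𝒦') {u, v}
        omega
  have hrest := hC.matchable_rest h.toBarrier hS h.card_sep_le
  have hsub := h.subset
  have hSC := h.sep_subset
  have hnot := fun L hL v => h.notMem (K := L) (v := v) hL
  have heq := fun L hL v => h.eq_of_mem (L := L) (v := v) hK hL
  have hu := h.left_mem
  have hv := h.right_mem
  refine (hunion.of_parts (matchable_pair huv) (U := S ∪ (𝒦.erase K).biUnion id) (fun x => ?_)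
    fun x hx => ?_).of_parts hrest (fun x => ?_) fun x hx => ?_
  all_goals
    simp only [mem_union, mem_sdiff, mem_insert, mem_singleton, mem_biUnion, mem_erase, id,
      Barrier.mem_rest] at *
    grind

lemma exists_tightBarrier (h : MinimalSplittingBarrier G C u v w S 𝒦) (hC : FactorCritical G C)
    (huv : u ≠ v) : ∃ 𝒵 ⊆ 𝒦, 𝒵.Nonempty ∧ TightBarrier G C (nbr G S 𝒵) 𝒵 := by
  have hS : S.Nonempty := ⟨u, h.left_mem⟩
  have h𝒦 : 𝒦.Nonempty := by
    have htwo := card_le_card (insert_subset h.left_mem (singleton_subset_iff.2 h.right_mem))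
    rw [card_pair huv] at htwo
    exact card_pos.1 (by have := h.card_sep_le; omega)
  obtain ⟨𝒵, ⟨h𝒵, hne, hcard⟩, hmin⟩ := exists_minimal_of_wellFoundedLT
    (fun 𝒵 : Finset (Finset V) => 𝒵 ⊆ 𝒦 ∧ 𝒵.Nonempty ∧ (nbr G S 𝒵).card ≤ 𝒵.card + 1)
    ⟨𝒦, Subset.rfl, h𝒦, (card_le_card nbr_subset).trans h.card_sep_le⟩
  refine ⟨𝒵, h𝒵, hne, h.restrict h𝒵, fun K hK => h.factorCritical (h𝒵 hK), ?_, ?_⟩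
  · have := hC.card_lt_card_nbr h.toBarrier hS h𝒵 hne
    omega
  · intro 𝒵' h𝒵' hne' hnonempty
    rw [nbr_nbr h𝒵']
    by_contra! hlt
    exact hne' (h𝒵'.antisymm (hmin ⟨h𝒵'.trans h𝒵, hnonempty, by omega⟩ h𝒵'))

end MinimalSplittingBarrier

namespace IsEnd

variable {C K X : Finset V}

lemma matchable_sdiff (h : IsEnd G C K X) {T : Finset V} (hT : T ⊆ K) (hm : Matchable G (K \ T)) :
    Matchable G (C \ T) := by
  refine hm.of_parts h.matchable ?_ ?_
  · have := h.subset
    grind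
  · grind

lemma matchable_sdiff_pair (h : IsEnd G C K X) {k x x' : V} (hk : k ∈ K) (hx : x ∈ X)
    (hx' : x' ∈ X) (hne : x ≠ x') : Matchable G (C \ {k, x, x'}) := by
  refine (h.factorCritical.2 k hk).of_parts (h.matchable_pair x hx x' hx' hne) ?_ ?_
  · have := h.subset
    have := h.notMem
    grind
  · grind

lemma matchable_of_cross (h : IsEnd G C K X) {T : Finset V} {k x : V} (hk : k ∈ K)
    (hx : x ∈ X) (hadj : G.Adj x k) (hm : Matchable G (K \ insert k T)) (hkT : k ∉ T)
    (hxT : x ∉ T) (hA : Matchable G ((C \ K) \ insert x T)) : Matchable G (C \ T) := by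
  have h1 := h.notMem x hx
  have h2 := h.attachment_subset hx
  have h3 := h.subset
  refine ((ExtendedMatching.matchable_pair hadj).of_parts hm (U := insert x (K \ T)) ?_ ?_).of_parts
    hA ?_ ?_ <;> grind

lemma matchable_of_cross_two (h : IsEnd G C K X) {T : Finset V} {k x k' x' : V} (hT : T ⊆ K)
    (hk : k ∈ K) (hk' : k' ∈ K) (hx : x ∈ X) (hx' : x' ∈ X) (hadj : G.Adj x k)
    (hadj' : G.Adj x' k') (hkk' : k ≠ k') (hxx' : x ≠ x') (hkT : k ∉ T) (hkT' : k' ∉ T)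
    (hm : Matchable G (K \ insert k (insert k' T))) : Matchable G (C \ T) := by
  have h1 := h.notMem
  have h2 := h.attachment_subset
  have h3 := h.subset
  have hA := h.matchable_pair x hx x' hx' hxx'
  refine (((ExtendedMatching.matchable_pair hadj).of_parts
    (ExtendedMatching.matchable_pair hadj') (U := {x, k, x', k'}) ?_ ?_).of_parts hm
    (U := insert x (insert x' (K \ T))) ?_ ?_).of_parts hA ?_ ?_ <;> grind

lemma not_matchable_of_cross (h : IsEnd G C K X) {p q r : V} (hp : p ∈ K) (hq : q ∈ K)
    (hr : r ∈ X) (hflat : ¬ Matchable G (C \ {p, q, r})) :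
    ∀ k ∈ K, k ≠ p → k ≠ q → ∀ x ∈ X, x ≠ r → G.Adj x k → ¬ Matchable G (K \ {k, p, q}) := by
  intro k hk hkp hkq x hxX hxr hadj hm
  have := h.notMem r hr
  have := h.notMem x hxX
  exact hflat (h.matchable_of_cross hk hxX hadj (hm.congr (by grind)) (by grind) (by grind)
    ((h.matchable_pair x hxX r hr hxr).congr (by grind)))

end IsEnd

/-- An end `K` attached to exactly two vertices `a` and `b`, with further vertices `W` beyond. -/
structure TwoEnd (G : SimpleGraph V) (C K W : Finset V) (a b : V) : Prop where
  factorCritical : FactorCritical G C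
  isEnd : IsEnd G C K {a, b}
  ne : a ≠ b
  adj_left : ∃ k ∈ K, G.Adj a k
  adj_right : ∃ k ∈ K, G.Adj b k
  rest_eq : W = (C \ K) \ {a, b}
  nonempty : W.Nonempty

/-- Two disjoint ends with a common attachment set, each joined to at least three vertices
of it. -/
structure TwoEnds (G : SimpleGraph V) (C K₁ K₂ X : Finset V) : Prop where
  left : IsEnd G C K₁ X
  right : IsEnd G C K₂ X
  disjoint : Disjoint K₁ K₂
  card_left : 3 ≤ (nbr G X {K₁}).card
  card_right : 3 ≤ (nbr G X {K₂}).card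

lemma TightBarrier.exists_twoEnd {C X K : Finset V} (h : TightBarrier G C X {K})
    (hC : FactorCritical G C) (hCK : Matchable G (C \ K)) (hlt : 2 < (C \ K).card) :
    ∃ W a b, TwoEnd G C K W a b := by
  have hK := mem_singleton_self K
  obtain ⟨a, b, hab, rfl⟩ := card_eq_two.1 (h.card_sep.trans (by rw [card_singleton]))
  have hnbr : nbr G {a, b} {K} = {a, b} := by
    refine eq_of_subset_of_card_le nbr_subset ?_
    have := hC.card_lt_card_nbr h.toBarrier h.sep_nonempty Subset.rfl (singleton_nonempty K)
    rw [card_singleton] at this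
    rwa [card_pair hab]
  have hadj : ∀ x ∈ ({a, b} : Finset V), ∃ k ∈ K, G.Adj x k := fun x hx =>
    (mem_nbr_singleton.1 (hnbr.ge hx)).2
  refine ⟨_, a, b, hC, h.isEnd hC hK hCK, hab, hadj a (by simp), hadj b (by simp), rfl, ?_⟩
  have := le_card_sdiff {a, b} (C \ K)
  rw [card_pair hab] at this
  exact card_pos.1 (by omega)

lemma TightBarrier.twoEnds {C X K₁ K₂ : Finset V} {𝒵 : Finset (Finset V)}
    (h : TightBarrier G C X 𝒵) (hC : FactorCritical G C)
    (hm : ∀ K ∈ 𝒵, Matchable G (C \ K)) (h₁ : K₁ ∈ 𝒵) (h₂ : K₂ ∈ 𝒵) (hne : K₁ ≠ K₂) :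
    TwoEnds G C K₁ K₂ X where
  left := h.isEnd hC h₁ (hm K₁ h₁)
  right := h.isEnd hC h₂ (hm K₂ h₂)
  disjoint := h.pairwiseDisjoint h₁ h₂ hne
  card_left := h.three_le_card_nbr h₁ fun heq => hne (mem_singleton.1 (heq ▸ h₂)).symm
  card_right := h.three_le_card_nbr h₂ fun heq => hne (mem_singleton.1 (heq ▸ h₁))

lemma exists_twoEnd_or_twoEnds {C : Finset V} (hC : FactorCritical G C) {u v w : V} (hu : u ∈ C)
    (hv : v ∈ C) (hw : w ∈ C) (huv : G.Adj u v) (huw : u ≠ w) (hvw : v ≠ w)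
    (hflat : ¬ Matchable G (C \ {u, v, w})) :
    (∃ K W a b, TwoEnd G C K W a b ∧ w ∉ K) ∨
    (∃ K₁ K₂ X, TwoEnds G C K₁ K₂ X ∧ w ∉ K₁ ∧ w ∉ K₂ ∧ ∃ g ∈ X, ∀ x ∈ X, x ≠ g →
        Matchable G ((C \ K₁) \ {w, x}) ∧ Matchable G ((C \ K₂) \ {w, x})) := by
  obtain ⟨S₀, 𝒦₀, h₀⟩ := exists_splittingBarrier hC hu hv hw huv.ne huw hvw hflat
  obtain ⟨S, 𝒦, hmin⟩ := h₀.exists_minimal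
  obtain ⟨𝒵, h𝒵, ⟨K, hK⟩, htight⟩ := hmin.exists_tightBarrier hC huv.ne
  have hm : ∀ K ∈ 𝒵, Matchable G (C \ K) := fun K hK => hmin.matchable_sdiff hC huv (h𝒵 hK)
  have hw𝒵 : ∀ K ∈ 𝒵, w ∉ K := fun K hK => hmin.notMem_member K (h𝒵 hK)
  by_cases hone : 𝒵 = {K}
  · subst hone
    have huK : u ∉ K := fun huK => hmin.notMem (h𝒵 hK) huK hmin.left_mem
    have hvK : v ∉ K := fun hvK => hmin.notMem (h𝒵 hK) hvK hmin.right_mem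
    have hlt : 2 < (C \ K).card := two_lt_card.2
      ⟨u, by grind, v, by grind, w, by grind, huv.ne, huw, hvw⟩
    obtain ⟨W, a, b, hTwoEnd⟩ := htight.exists_twoEnd hC (hm K hK) hlt
    exact .inl ⟨K, W, a, b, hTwoEnd, hw𝒵 K hK⟩
  · obtain ⟨L, hL, hLK⟩ : ∃ L ∈ 𝒵, L ≠ K := by
      by_contra! hall
      exact hone (eq_singleton_iff_unique_mem.2 ⟨hK, hall⟩)
    obtain ⟨g, hg, hgate⟩ := htight.exists_gate hC hw hw𝒵
    exact .inr ⟨L, K, _, htight.twoEnds hC hm hL hK hLK, hw𝒵 L hL, hw𝒵 K hK, g, hg,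
      fun x hx hxg => ⟨hgate x hx hxg L hL, hgate x hx hxg K hK⟩⟩

end End

/-! ### Weights -/

section Weight

variable {V : Type*} {G : SimpleGraph V}

/-- The graph in which the neighborhood of the vertex `a` is replaced by `N`. -/
def rewire (G : SimpleGraph V) (a : V) (N : Set V) : SimpleGraph V :=
  SimpleGraph.fromRel fun u v => (u ≠ a ∧ v ≠ a ∧ G.Adj u v) ∨ (u = a ∧ v ∈ N)

lemma rewire_adj {a u v : V} {N : Set V} (hu : u ≠ a) (hv : v ≠ a) :
    (rewire G a N).Adj u v ↔ G.Adj u v := by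
  simp only [rewire, SimpleGraph.fromRel_adj, hu, hv, G.adj_comm v u]
  grind [G.ne_of_adj]

lemma rewire_adj_left {a v : V} {N : Set V} (hv : v ≠ a) : (rewire G a N).Adj a v ↔ v ∈ N := by
  simp only [rewire, SimpleGraph.fromRel_adj, hv]
  grind

lemma matchable_rewire_iff {U : Finset V} {a : V} {N : Set V} (ha : a ∉ U) :
    Matchable (rewire G a N) U ↔ Matchable G U := by
  have hadj : ∀ u ∈ U, ∀ v ∈ U, (rewire G a N).Adj u v ↔ G.Adj u v := fun u hu v hv =>
    rewire_adj (ne_of_mem_of_not_mem hu ha) (ne_of_mem_of_not_mem hv ha)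
  exact ⟨fun h => h.mono fun u hu v hv => (hadj u hu v hv).1,
    fun h => h.mono fun u hu v hv => (hadj u hu v hv).2⟩

variable [DecidableEq V]

/-- The weight of the triangle `p q r` is nonpositive if its deletion from `C` leaves an
unmatchable set. -/
def TriangleBound (G : SimpleGraph V) (C : Finset V) (y : V → ℤ) (p q r : V) : Prop :=
  G.Adj p q → G.Adj q r → G.Adj p r → ¬ Matchable G (C \ {p, q, r}) → y p + y q + y r ≤ 0

lemma TriangleBound.swap_left {C : Finset V} {y : V → ℤ} {p q r : V}
    (h : TriangleBound G C y p q r) : TriangleBound G C y q p r := fun hqp hpr hqr hflat => by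
  have := h hqp.symm hqr hpr (by rwa [insert_comm])
  omega

lemma TriangleBound.swap_right {C : Finset V} {y : V → ℤ} {p q r : V}
    (h : TriangleBound G C y p q r) : TriangleBound G C y p r q := fun hpr hrq hpq hflat => by
  have := h hpq hrq.symm hpr (by rwa [pair_comm])
  omega

lemma triangleBound_of_sorted {C D : Finset V} {y : V → ℤ} (c : V → ℕ)
    (h : ∀ p ∈ D, ∀ q ∈ D, ∀ r ∈ D, c p ≤ c q → c q ≤ c r → TriangleBound G C y p q r) :
    ∀ p ∈ D, ∀ q ∈ D, ∀ r ∈ D, TriangleBound G C y p q r := by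
  have hmin : ∀ p ∈ D, ∀ q ∈ D, ∀ r ∈ D, c p ≤ c q → c p ≤ c r → TriangleBound G C y p q r := by
    intro p hp q hq r hr hpq hpr
    rcases le_total (c q) (c r) with hqr | hrq
    · exact h p hp q hq r hr hpq hqr
    · exact (h p hp r hr q hq hpr hrq).swap_right
  intro p hp q hq r hr
  by_cases hpmin : c p ≤ c q ∧ c p ≤ c r
  · exact hmin p hp q hq r hr hpmin.1 hpmin.2
  rcases le_total (c q) (c r) with hqr | hrq
  · exact (hmin q hq p hp r hr (by omega) hqr).swap_left
  · exact (hmin r hr p hp q hq (by omega) hrq).swap_left.swap_right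

/-- The weight of the edge `p q` is nonpositive if its deletion together with `j` from `C` leaves
an unmatchable set. -/
def PairBound (G : SimpleGraph V) (C : Finset V) (j : V) (y : V → ℤ) (p q : V) : Prop :=
  G.Adj p q → ¬ Matchable G (C \ {j, p, q}) → y p + y q ≤ 0

lemma pairBound_of_sorted {C D : Finset V} {j : V} {y : V → ℤ} (c : V → ℕ)
    (h : ∀ p ∈ D, ∀ q ∈ D, c p ≤ c q → PairBound G C j y p q) :
    ∀ p ∈ D, ∀ q ∈ D, PairBound G C j y p q := by
  intro p hp q hq
  rcases le_total (c p) (c q) with hle | hle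
  · exact h p hp q hq hle
  · intro hpq hflat
    have := h q hq p hp hle hpq.symm (by rwa [pair_comm])
    omega

/-- A weight on a factor-critical set `U` of total at least two that is nonpositive on every
triangle whose deletion leaves an unmatchable set. -/
structure ExcessWeight (G : SimpleGraph V) (U : Finset V) (y : V → ℤ) : Prop where
  upper : ∀ v ∈ U, y v ≤ 1
  total : 2 ≤ ∑ v ∈ U, y v
  triangle : ∀ p ∈ U, ∀ q ∈ U, ∀ r ∈ U, TriangleBound G U y p q r

/-- A weight on a factor-critical set `U` with a root `j`, the counterpart of `ExcessWeight` that
allows for an induction. The conditions at `j` account for `U` being attached at `j` to the rest of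
a larger graph. -/
structure RootedWeight (G : SimpleGraph V) (U : Finset V) (j : V) (y : V → ℤ) : Prop where
  lower : ∀ v ∈ U, -1 ≤ y v
  upper : ∀ v ∈ U, y v ≤ 1
  root : y j ≤ 0
  total : 1 ≤ ∑ v ∈ U, y v
  edge : ∀ k ∈ U, G.Adj j k → y j + y k ≤ 0
  pair : ∀ p ∈ U.erase j, ∀ q ∈ U.erase j, PairBound G U j y p q
  triangle : ∀ p ∈ U.erase j, ∀ q ∈ U.erase j, ∀ r ∈ U.erase j, TriangleBound G U y p q r

/-- Rooted weights exist on all factor-critical sets with at least three and fewer than `n`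
vertices: the induction hypothesis of the construction of rooted weights. -/
def HasRootedWeights (V : Type*) [DecidableEq V] (n : ℕ) : Prop :=
  ∀ (G : SimpleGraph V) (U : Finset V) (j : V), U.card < n → FactorCritical G U → 3 ≤ U.card →
    j ∈ U → ∃ y, RootedWeight G U j y

lemma factorCritical_rewire {W : Finset V} {a : V} {N : Set V} (ha : a ∉ W) (hW : Matchable G W)
    (hN : ∀ v ∈ W, ∃ u ∈ W.erase v, u ∈ N ∧ Matchable G ((W.erase v).erase u)) :
    FactorCritical (rewire G a N) (insert a W) := by
  refine ⟨⟨a, mem_insert_self a W⟩, fun v hv => ?_⟩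
  rcases mem_insert.1 hv with rfl | hv
  · rwa [erase_insert ha, matchable_rewire_iff ha]
  obtain ⟨u, hu, huN, hm⟩ := hN v hv
  have hua : u ≠ a := by grind
  refine (matchable_pair ((rewire_adj_left hua).2 huN)).of_parts
    ((matchable_rewire_iff (by grind)).2 hm) ?_ ?_ <;> grind

lemma Matchable.exists_mem_of_rewire {U : Finset V} {a : V} {N : Set V}
    (h : Matchable (rewire G a N) U) (ha : a ∈ U) :
    ∃ u ∈ U, u ≠ a ∧ u ∈ N ∧ Matchable G (U \ {a, u}) := by
  obtain ⟨u, hu, hadj, hm⟩ := h.exists_partner ha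
  have hua := hadj.ne'
  exact ⟨u, hu, hua, (rewire_adj_left hua).1 hadj, (matchable_rewire_iff (by grind)).1 hm⟩

lemma TriangleBound.of_rewire {C U : Finset V} {a : V} {N : Set V} {y : V → ℤ} {p q r : V}
    (h : TriangleBound (rewire G a N) U y p q r) (hp : p ≠ a) (hq : q ≠ a) (hr : r ≠ a)
    (hm : Matchable (rewire G a N) (U \ {p, q, r}) → Matchable G (C \ {p, q, r})) :
    TriangleBound G C y p q r := fun hpq hqr hpr hflat =>
  h ((rewire_adj hp hq).2 hpq) ((rewire_adj hq hr).2 hqr) ((rewire_adj hp hr).2 hpr)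
    fun hU => hflat (hm hU)

/-- The edges of `K` whose deletion leaves a set that cannot be matched with one edge going to `b`
have nonpositive weight. -/
def EndPairBound (G : SimpleGraph V) (K : Finset V) (b : V) (y : V → ℤ) : Prop :=
  ∀ p ∈ K, ∀ q ∈ K, G.Adj p q →
    (∀ k ∈ K, k ≠ p → k ≠ q → G.Adj b k → ¬ Matchable G (K \ {k, p, q})) → y p + y q ≤ 0

/-- A weight `y` on an end `K` of `C`, together with a value `B` for the attachment `b` and a
value `A` for each of the other attachments. -/
structure EndValues (G : SimpleGraph V) (C K X : Finset V) (b : V) (y : V → ℤ) (A B : ℤ) :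
    Prop where
  lower : ∀ k ∈ K, -1 ≤ y k
  upper : ∀ k ∈ K, y k ≤ 1
  lower_left : -1 ≤ A
  upper_left : A ≤ 0
  lower_right : -1 ≤ B
  upper_right : B ≤ 1
  add_le : A + B ≤ 0
  total : 1 ≤ ∑ k ∈ K, y k + A + B
  edge : ∀ k ∈ K, ∀ x ∈ X, x ≠ b → G.Adj x k → y k + A ≤ 0
  triangle : ∀ p ∈ K, ∀ q ∈ K, ∀ r ∈ K, TriangleBound G C y p q r
  pair : EndPairBound G K b y
  pair_right : ∀ p ∈ K, ∀ q ∈ K, G.Adj p q → G.Adj b p → G.Adj b q →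
    (∀ k ∈ K, k ≠ p → k ≠ q → ∀ x ∈ X, x ≠ b → G.Adj x k →
    ¬ Matchable G (K \ {k, p, q})) → y p + y q + B ≤ 0

/-- The neighborhood of the new vertex when all attachments other than `b` are contracted into a
single vertex, which is moreover joined to `b`. -/
def attachNbr (G : SimpleGraph V) (X : Finset V) (b : V) : Set V :=
  {v | v = b ∨ ∃ x ∈ X, x ≠ b ∧ G.Adj x v}

namespace IsEnd

variable {C K X : Finset V} {a b : V}

lemma factorCritical_rewire (h : IsEnd G C K X) (ha : a ∈ X) (hbX : b ∈ X) (hab : a ≠ b)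
    (hb : ∃ k ∈ K, G.Adj b k) (hx : ∃ x ∈ X, x ≠ b ∧ ∃ k ∈ K, G.Adj x k) :
    FactorCritical (rewire G a (attachNbr G X b)) (insert a (insert b K)) := by
  have haK := h.notMem a ha
  have hbK := h.notMem b hbX
  have hm : Matchable G (insert b K) := by
    obtain ⟨k, hk, hadj⟩ := hb
    exact h.factorCritical.matchable_insert hbK hk hadj
  refine ExtendedMatching.factorCritical_rewire (by grind) hm fun v hv => ?_
  rcases eq_or_ne v b with rfl | hvb
  · obtain ⟨x, hxX, hxb, k, hk, hadj⟩ := hx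
    refine ⟨k, by grind, .inr ⟨x, hxX, hxb, hadj⟩, ?_⟩
    rw [erase_insert hbK]
    exact h.factorCritical.2 k hk
  · have hvK : v ∈ K := by grind
    exact ⟨b, by grind, .inl rfl, (h.factorCritical.2 v hvK).congr (by grind)⟩

lemma matchable_of_rewire (h : IsEnd G C K X) (ha : a ∈ X) (hbX : b ∈ X) (hab : a ≠ b)
    {T : Finset V} (hT : T ⊆ K)
    (hm : Matchable (rewire G a (attachNbr G X b)) (insert a (insert b K) \ T)) :
    Matchable G (C \ T) := by
  have haK := h.notMem a ha
  have hbK := h.notMem b hbX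
  obtain ⟨k, hk, hka, rfl | ⟨x, hxX, hxb, hxk⟩, hm'⟩ := hm.exists_mem_of_rewire (by grind)
  · exact h.matchable_sdiff hT (hm'.congr (by grind))
  rcases eq_or_ne k b with rfl | hkb
  · exact h.matchable_sdiff hT (hm'.congr (by grind))
  · obtain ⟨k', hk', hadj', hm''⟩ := hm'.exists_partner (x := b) (by grind)
    have hkb' := hadj'.ne'
    exact h.matchable_of_cross_two hT (k := k) (k' := k') (by grind) (by grind) hxX hbX hxk hadj'
      (by grind) hxb (by grind) (by grind) (hm''.congr (by grind))

lemma endPairBound_of_rootedWeight {y : V → ℤ} {N : Set V} (haK : a ∉ K) (hbK : b ∉ K)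
    (hab : a ≠ b) (hy : RootedWeight (rewire G a N) (insert a (insert b K)) a y) :
    EndPairBound G K b y := by
  intro p hp q hq hpq hno
  refine hy.pair p (by grind) q (by grind)
    ((rewire_adj (by grind) (by grind)).2 hpq) fun hm => ?_
  rw [matchable_rewire_iff (by grind)] at hm
  obtain ⟨k, hk, hadj, hm'⟩ := hm.exists_partner (x := b) (by grind)
  have := hadj.ne
  exact hno k (by grind) (by grind) (by grind) hadj (hm'.congr (by grind))

lemma pair_right_of_rootedWeight {y : V → ℤ} (haK : a ∉ K) (hbK : b ∉ K) (hab : a ≠ b)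
    (hy : RootedWeight (rewire G a (attachNbr G X b)) (insert a (insert b K)) a y) {p q : V}
    (hp : p ∈ K) (hq : q ∈ K) (hpq : G.Adj p q) (hbp : G.Adj b p) (hbq : G.Adj b q)
    (hno : ∀ k ∈ K, k ≠ p → k ≠ q → ∀ x ∈ X, x ≠ b → G.Adj x k → ¬ Matchable G (K \ {k, p, q})) :
    y p + y q + y b ≤ 0 := by
  have hpa : p ≠ a := by grind
  have hqa : q ≠ a := by grind
  refine hy.triangle p (by grind) q (by grind) b (by grind) ((rewire_adj hpa hqa).2 hpq)
    ((rewire_adj hqa hab.symm).2 hbq.symm) ((rewire_adj hpa hab.symm).2 hbp.symm) fun hm => ?_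
  obtain ⟨k, hk, hka, rfl | ⟨x, hxX, hxb, hxk⟩, hm'⟩ := hm.exists_mem_of_rewire (by grind)
  · grind
  · exact hno k (by grind) (by grind) (by grind) x hxX hxb hxk (hm'.congr (by grind))

lemma exists_endValues (h : IsEnd G C K X) (hIH : HasRootedWeights V C.card)
    (hlt : K.card + 2 < C.card) (ha : a ∈ X) (hbX : b ∈ X) (hab : a ≠ b)
    (hb : ∃ k ∈ K, G.Adj b k) (hx : ∃ x ∈ X, x ≠ b ∧ ∃ k ∈ K, G.Adj x k) :
    ∃ y A B, EndValues G C K X b y A B := by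
  have haK := h.notMem a ha
  have hbK := h.notMem b hbX
  have hab' : a ∉ insert b K := by grind
  have hcard : (insert a (insert b K)).card = K.card + 2 := by
    rw [card_insert_of_notMem hab', card_insert_of_notMem hbK]
  have hpos := card_pos.2 h.factorCritical.1
  obtain ⟨y, hy⟩ := hIH (rewire G a (attachNbr G X b)) (insert a (insert b K)) a (by omega)
    (h.factorCritical_rewire ha hbX hab hb hx) (by omega) (by simp)
  have hne : ∀ k ∈ K, k ≠ a := fun k hk => ne_of_mem_of_not_mem hk haK
  exact ⟨y, y a, y b,
    { lower := fun k hk => hy.lower k (by simp [hk])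
      upper := fun k hk => hy.upper k (by simp [hk])
      lower_left := hy.lower a (by simp)
      upper_left := hy.root
      lower_right := hy.lower b (by simp)
      upper_right := hy.upper b (by simp)
      add_le := hy.edge b (by simp) ((rewire_adj_left hab.symm).2 (.inl rfl))
      total := by
        have := hy.total
        rw [sum_insert hab', sum_insert hbK] at this
        omega
      edge := fun k hk x hxX hxb hadj => by
        have := hy.edge k (by simp [hk])
          ((rewire_adj_left (hne k hk)).2 (.inr ⟨x, hxX, hxb, hadj⟩))
        omega
      triangle := fun p hp q hq r hr =>
        (hy.triangle p (by grind) q (by grind) r (by grind)).of_rewire (hne p hp) (hne q hq)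
          (hne r hr) (h.matchable_of_rewire ha hbX hab (by grind))
      pair := endPairBound_of_rootedWeight haK hbK hab hy
      pair_right := fun _ hp _ hq => pair_right_of_rootedWeight haK hbK hab hy hp hq }⟩

end IsEnd

/-- A weight on `C` supported on an end `K` and one of its attachments `b`. -/
structure EndWeight (G : SimpleGraph V) (C K : Finset V) (b : V) (z : V → ℤ) : Prop where
  lower : ∀ v, -1 ≤ z v
  upper : ∀ v, z v ≤ 1
  nonpos : ∀ v, v ∉ K → z v ≤ 0
  zero : ∀ v, v ∉ K → v ≠ b → z v = 0
  total : 1 ≤ ∑ v ∈ C, z v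
  triangle : ∀ p ∈ C, ∀ q ∈ C, ∀ r ∈ C, TriangleBound G C z p q r
  pair : EndPairBound G K b z

lemma EndValues.triangleBound {C K X : Finset V} {b : V} {y z : V → ℤ} {A B : ℤ}
    (hy : EndValues G C K X b y A B) (h : IsEnd G C K X) (hbX : b ∈ X)
    (hzK : ∀ v ∈ K, z v = y v) (hzb : z b ≤ B) (hneg : ∀ v, v ∉ K → z v ≤ 0) :
    ∀ p ∈ C, ∀ q ∈ C, ∀ r ∈ C, TriangleBound G C z p q r := by
  refine triangleBound_of_sorted (fun v => if v ∈ K then 0 else 1) ?_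
  intro p _ q hq r hr hle_pq hle_qr hpq hqr hpr hflat
  by_cases hpK : p ∈ K
  swap
  · have hqK : q ∉ K := fun hq => by simp [hpK, hq] at hle_pq
    have hrK : r ∉ K := fun hr => by simp [hqK, hr] at hle_qr
    have := hneg p hpK
    have := hneg q hqK
    have := hneg r hrK
    omega
  by_cases hrK : r ∈ K
  · have hqK : q ∈ K := by
      by_contra hq
      simp [hq, hrK] at hle_qr
    rw [hzK p hpK, hzK q hqK, hzK r hrK]
    exact hy.triangle p hpK q hqK r hrK hpq hqr hpr hflat
  have hrX : r ∈ X := (h.mem_or_mem p hpK r hr hpr).resolve_left hrK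
  by_cases hqK : q ∈ K
  swap
  · have hqX : q ∈ X := (h.mem_or_mem p hpK q hq hpq).resolve_left hqK
    exact absurd (h.matchable_sdiff_pair hpK hqX hrX hqr.ne) hflat
  have hno := h.not_matchable_of_cross hpK hqK hrX hflat
  rw [hzK p hpK, hzK q hqK]
  rcases eq_or_ne r b with rfl | hrb
  · have := hy.pair_right p hpK q hqK hpq hpr.symm hqr.symm hno
    omega
  · have := hy.pair p hpK q hqK hpq fun k hk hkp hkq => hno k hk hkp hkq b hbX hrb.symm
    have := hneg r hrK
    omega

lemma EndValues.exists_endWeight {C K X : Finset V} {b : V} {y : V → ℤ} {A B : ℤ}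
    (hy : EndValues G C K X b y A B) (h : IsEnd G C K X) (hbX : b ∈ X) :
    ∃ z, EndWeight G C K b z := by
  have hbK := h.notMem b hbX
  have hA := hy.upper_left
  have hB := hy.lower_right
  let z : V → ℤ := fun v => if v ∈ K then y v else if v = b then min B 0 else 0
  have hzK : ∀ v ∈ K, z v = y v := fun v hv => by simp [z, hv]
  have hzb : z b = min B 0 := by simp [z, hbK]
  have hz0 : ∀ v, v ∉ K → v ≠ b → z v = 0 := fun v hv hvb => by simp [z, hv, hvb]
  have hneg : ∀ v, v ∉ K → z v ≤ 0 := fun v hv => by grind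
  have htotal : ∑ v ∈ C, z v = min B 0 + ∑ k ∈ K, y k := by
    rw [← sum_subset (insert_subset (h.attachment_subset hbX) h.subset) fun v _ hv =>
      hz0 v (fun hvK => hv (mem_insert_of_mem hvK)) (fun hvb => hv (hvb ▸ mem_insert_self b K)),
      sum_insert hbK, hzb, sum_congr rfl hzK]
  refine ⟨z, fun v => ?_, fun v => ?_, hneg, hz0, ?_,
    hy.triangleBound h hbX hzK (hzb ▸ min_le_left B 0) hneg, fun p hp q hq => ?_⟩
  · have := hy.lower v
    grind
  · have := hy.upper v
    grind
  · have := hy.total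
    have := hy.add_le
    omega
  · rw [hzK p hp, hzK q hq]
    exact hy.pair p hp q hq

lemma IsEnd.exists_endWeight_of_three_le {C K X : Finset V} (h : IsEnd G C K X)
    (hIH : HasRootedWeights V C.card) (h3 : 3 ≤ (nbr G X {K}).card) {b : V}
    (hb : b ∈ nbr G X {K}) : ∃ z, EndWeight G C K b z := by
  obtain ⟨a, ha, hab⟩ := exists_mem_ne (by omega : 1 < (nbr G X {K}).card) b
  have hlt : K.card + 2 < C.card := by
    have hdisj : Disjoint K (nbr G X {K}) :=
      Finset.disjoint_left.2 fun v hv hv' => h.notMem v (nbr_subset hv') hv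
    have := card_le_card (union_subset h.subset (nbr_subset.trans h.attachment_subset) :
      K ∪ nbr G X {K} ⊆ C)
    rw [card_union_of_disjoint hdisj] at this
    omega
  rw [mem_nbr_singleton] at ha hb
  obtain ⟨y, A, B, hy⟩ := h.exists_endValues hIH hlt ha.1 hb.1 hab hb.2 ⟨a, ha.1, hab, ha.2⟩
  exact hy.exists_endWeight h hb.1

namespace TwoEnd

variable {C K W : Finset V} {a b : V}

lemma symm (h : TwoEnd G C K W a b) : TwoEnd G C K W b a :=
  ⟨h.factorCritical, pair_comm a b ▸ h.isEnd, h.ne.symm, h.adj_right, h.adj_left,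
    pair_comm a b ▸ h.rest_eq, h.nonempty⟩

lemma left_notMem (h : TwoEnd G C K W a b) : a ∉ K :=
  h.isEnd.notMem a (by simp)

lemma right_notMem (h : TwoEnd G C K W a b) : b ∉ K :=
  h.isEnd.notMem b (by simp)

lemma left_mem (h : TwoEnd G C K W a b) : a ∈ C :=
  h.isEnd.attachment_subset (by simp)

lemma right_mem (h : TwoEnd G C K W a b) : b ∈ C :=
  h.isEnd.attachment_subset (by simp)

lemma mem_rest (h : TwoEnd G C K W a b) {v : V} : v ∈ W ↔ v ∈ C ∧ v ∉ K ∧ v ≠ a ∧ v ≠ b := by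
  rw [h.rest_eq]
  grind

lemma left_notMem_rest (h : TwoEnd G C K W a b) : a ∉ W := fun ha => (h.mem_rest.1 ha).2.2.1 rfl

lemma right_notMem_rest (h : TwoEnd G C K W a b) : b ∉ W := fun hb => (h.mem_rest.1 hb).2.2.2 rfl

lemma not_adj (h : TwoEnd G C K W a b) {k w : V} (hk : k ∈ K) (hw : w ∈ W) : ¬ G.Adj k w := by
  intro hadj
  have hw' := h.mem_rest.1 hw
  have := h.isEnd.mem_or_mem k hk w hw'.1 hadj
  grind

lemma matchable_rest (h : TwoEnd G C K W a b) : Matchable G W :=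
  h.rest_eq ▸ h.isEnd.matchable_pair a (by simp) b (by simp) h.ne

lemma matchable_insert_right (h : TwoEnd G C K W a b) : Matchable G (insert b K) := by
  obtain ⟨k, hk, hadj⟩ := h.adj_right
  exact h.isEnd.factorCritical.matchable_insert h.right_notMem hk hadj

lemma cases (h : TwoEnd G C K W a b) {v : V} (hv : v ∈ C) : v ∈ K ∨ v = a ∨ v = b ∨ v ∈ W := by
  rw [h.mem_rest]
  tauto

lemma eq_insert (h : TwoEnd G C K W a b) : C = insert a (insert b (K ∪ W)) := by
  ext v
  have := h.mem_rest (v := v)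
  have := h.left_mem
  have := h.right_mem
  have := h.isEnd.subset
  grind

lemma disjoint_rest (h : TwoEnd G C K W a b) : Disjoint K W :=
  Finset.disjoint_left.2 fun _ hv hw => (h.mem_rest.1 hw).2.1 hv

lemma right_notMem_union (h : TwoEnd G C K W a b) : b ∉ K ∪ W := by
  have := h.right_notMem
  have := h.right_notMem_rest
  grind

lemma left_notMem_insert (h : TwoEnd G C K W a b) : a ∉ insert b (K ∪ W) := by
  have := h.left_notMem
  have := h.left_notMem_rest
  have := h.ne
  grind

lemma card_eq (h : TwoEnd G C K W a b) : C.card = K.card + W.card + 2 := by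
  rw [h.eq_insert, card_insert_of_notMem h.left_notMem_insert,
    card_insert_of_notMem h.right_notMem_union, card_union_of_disjoint h.disjoint_rest]

lemma barrier (h : TwoEnd G C K W a b) : Barrier G C {a, b} {K} where
  sep_subset := h.isEnd.attachment_subset
  subset L hL := mem_singleton.1 hL ▸ h.isEnd.subset
  disjoint L hL := by
    rw [mem_singleton.1 hL]
    exact Finset.disjoint_right.2 h.isEnd.notMem
  odd_card L hL := mem_singleton.1 hL ▸ h.isEnd.factorCritical.odd_card
  pairwiseDisjoint := by simp
  mem_or_mem L hL := mem_singleton.1 hL ▸ h.isEnd.mem_or_mem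

lemma exists_attach (h : TwoEnd G C K W a b) {w : V} (hw : w ∈ W) :
    Matchable G (insert a (W.erase w)) ∨ Matchable G (insert b (W.erase w)) := by
  have hw' := h.mem_rest.1 hw
  have hBw := h.barrier.erase (v := w) fun L hL => mem_singleton.1 hL ▸ hw'.2.1
  rw [erase_eq_of_notMem (s := {a, b}) (by simp [hw'.2.2])] at hBw
  have hrest : Barrier.rest (C.erase w) {a, b} {K} = W.erase w := by
    ext z
    simp only [Barrier.mem_rest, mem_erase, h.mem_rest, mem_insert, mem_singleton, forall_eq]
    tauto
  have hodd : Odd (Barrier.rest (C.erase w) {a, b} {K}).card := by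
    rw [hrest, card_erase_of_mem hw]
    have := card_pos.2 ⟨w, hw⟩
    obtain ⟨m, hm⟩ := h.matchable_rest.even_card
    exact ⟨m - 1, by omega⟩
  have hcard : ({a, b} : Finset V).card ≤
      (insert (Barrier.rest (C.erase w) {a, b} {K}) {K} : Finset (Finset V)).card := by
    rw [Barrier.card_insert_rest hodd, card_pair h.ne, card_singleton]
  obtain ⟨s, hs, hsm⟩ := ((hBw.insert_rest hodd).matchable_of_card_le
    (h.factorCritical.2 w hw'.1) hcard).1 _ (mem_insert_self _ _)
  rw [hrest] at hsm
  rcases mem_insert.1 hs with rfl | hs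
  · exact .inl hsm
  · exact .inr (mem_singleton.1 hs ▸ hsm)

end TwoEnd

/-- The joint neighborhood of the two attachments of an end, which becomes the neighborhood of the
first one when the two are identified. -/
def jointNbr (G : SimpleGraph V) (a b : V) : Set V :=
  {v | G.Adj a v ∨ G.Adj b v}

namespace TwoEnd

variable {C K W : Finset V} {a b : V}

lemma factorCritical_rewire (h : TwoEnd G C K W a b) :
    FactorCritical (rewire G a (jointNbr G a b)) (insert a W) := by
  refine ExtendedMatching.factorCritical_rewire h.left_notMem_rest h.matchable_rest fun v hv => ?_
  have haW := h.left_notMem_rest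
  have hbW := h.right_notMem_rest
  rcases h.exists_attach hv with hm | hm
  · obtain ⟨u, hu, hadj, hm'⟩ := hm.exists_partner (x := a) (by simp)
    have := hadj.ne
    exact ⟨u, by grind, .inl hadj, hm'.congr (by grind)⟩
  · obtain ⟨u, hu, hadj, hm'⟩ := hm.exists_partner (x := b) (by simp)
    have := hadj.ne
    exact ⟨u, by grind, .inr hadj, hm'.congr (by grind)⟩

lemma matchable_sdiff_insert (h : TwoEnd G C K W a b) {T : Finset V} (hT : T ⊆ W)
    (hm : Matchable G (W \ T)) : Matchable G (C \ insert a T) := by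
  have hmem := fun v => h.mem_rest (v := v)
  have hb := h.right_mem
  have haK := h.left_notMem
  have hab := h.ne
  have hTW : ∀ v ∈ T, v ∈ W := hT
  have hKC : ∀ v ∈ K, v ∈ C := h.isEnd.subset
  clear hT
  refine hm.of_parts h.matchable_insert_right (fun v => ?_) ?_
  · simp only [mem_sdiff, mem_insert, hmem]
    grind
  · grind

lemma matchable_of_adj_left (h : TwoEnd G C K W a b) {T : Finset V} {u : V} (hT : T ⊆ W)
    (hu : u ∈ W) (huT : u ∉ T) (hadj : G.Adj a u) (hm : Matchable G ((W \ T).erase u)) :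
    Matchable G (C \ T) := by
  have haW := h.left_notMem_rest
  refine (matchable_pair hadj).of_parts (h.matchable_sdiff_insert (T := insert u T) (by grind)
    (hm.congr (by grind))) ?_ ?_
  · have := h.left_mem
    have := h.mem_rest.1 hu
    grind
  · grind

lemma matchable_of_rewire (h : TwoEnd G C K W a b) {T : Finset V} (hT : T ⊆ W)
    (hm : Matchable (rewire G a (jointNbr G a b)) (insert a W \ T)) : Matchable G (C \ T) := by
  have haW := h.left_notMem_rest
  obtain ⟨u, hu, hua, hadj | hadj, hm'⟩ := hm.exists_mem_of_rewire (by grind)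
  · exact h.matchable_of_adj_left hT (by grind) (by grind) hadj (hm'.congr (by grind))
  · exact h.symm.matchable_of_adj_left hT (by grind) (by grind) hadj (hm'.congr (by grind))

end TwoEnd

/-- A weight `y` on the part `W` beyond an end with attachments `a` and `b`, together with a value
`R` for the vertex obtained by identifying `a` and `b`. -/
structure RestValues (G : SimpleGraph V) (C W : Finset V) (a b : V) (y : V → ℤ) (R : ℤ) :
    Prop where
  lower : ∀ w ∈ W, -1 ≤ y w
  upper : ∀ w ∈ W, y w ≤ 1
  lower_root : -1 ≤ R
  upper_root : R ≤ 0
  total : 1 ≤ ∑ w ∈ W, y w + R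
  edge : ∀ w ∈ W, w ∈ jointNbr G a b → R + y w ≤ 0
  pair : ∀ p ∈ W, ∀ q ∈ W, G.Adj p q → ¬ Matchable G (W \ {p, q}) → y p + y q ≤ 0
  triangle : ∀ p ∈ W, ∀ q ∈ W, ∀ r ∈ W, TriangleBound G C y p q r

/-- The analogue of `RestValues` for a weight that is rooted at a vertex `j` of `W` instead of the
vertex obtained by identifying `a` and `b`. -/
structure RootedRestValues (G : SimpleGraph V) (C W : Finset V) (a b j : V) (y : V → ℤ) (R : ℤ) :
    Prop where
  lower : ∀ w ∈ W, -1 ≤ y w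
  upper : ∀ w ∈ W, y w ≤ 1
  root : y j ≤ 0
  lower_attach : -1 ≤ R
  upper_attach : R ≤ 1
  total : 1 ≤ ∑ w ∈ W, y w + R
  edge : ∀ w ∈ W, G.Adj j w → y j + y w ≤ 0
  edge_attach : j ∈ jointNbr G a b → y j + R ≤ 0
  pair : ∀ p ∈ W.erase j, ∀ q ∈ W.erase j, PairBound G C j y p q
  pair_attach : ∀ w ∈ W.erase j, w ∈ jointNbr G a b → ¬ Matchable G (W \ {j, w}) → R + y w ≤ 0
  triangle : ∀ p ∈ W.erase j, ∀ q ∈ W.erase j, ∀ r ∈ W.erase j, TriangleBound G C y p q r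
  triangle_attach : ∀ p ∈ W.erase j, ∀ q ∈ W.erase j, G.Adj p q → p ∈ jointNbr G a b →
    q ∈ jointNbr G a b → ¬ Matchable G (W \ {p, q}) → R + y p + y q ≤ 0

namespace TwoEnd

variable {C K W : Finset V} {a b : V}

lemma three_le_card_insert (h : TwoEnd G C K W a b) : 3 ≤ (insert a W).card := by
  rw [card_insert_of_notMem h.left_notMem_rest]
  obtain ⟨m, hm⟩ := h.matchable_rest.even_card
  have := card_pos.2 h.nonempty
  omega

lemma card_insert_lt (h : TwoEnd G C K W a b) : (insert a W).card < C.card := by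
  rw [card_insert_of_notMem h.left_notMem_rest, h.card_eq]
  omega

lemma exists_restValues (h : TwoEnd G C K W a b) (hIH : HasRootedWeights V C.card) :
    ∃ y R, RestValues G C W a b y R := by
  have haW := h.left_notMem_rest
  obtain ⟨y, hy⟩ := hIH _ (insert a W) a h.card_insert_lt h.factorCritical_rewire
    h.three_le_card_insert (by simp)
  have hne : ∀ w ∈ W, w ≠ a := fun w hw => ne_of_mem_of_not_mem hw haW
  have hmem : ∀ w ∈ W, w ∈ (insert a W).erase a := by grind
  exact ⟨y, y a,
    { lower := fun w hw => hy.lower w (by simp [hw])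
      upper := fun w hw => hy.upper w (by simp [hw])
      lower_root := hy.lower a (by simp)
      upper_root := hy.root
      total := by
        have := hy.total
        rw [sum_insert haW] at this
        omega
      edge := fun w hw hadj => hy.edge w (by simp [hw]) ((rewire_adj_left (hne w hw)).2 hadj)
      pair := fun p hp q hq hpq hflat => hy.pair p (hmem p hp) q (hmem q hq)
        ((rewire_adj (hne p hp) (hne q hq)).2 hpq) fun hm =>
          hflat (((matchable_rewire_iff (by simp)).1 hm).congr (by grind))
      triangle := fun p hp q hq r hr =>
        (hy.triangle p (hmem p hp) q (hmem q hq) r (hmem r hr)).of_rewire (hne p hp) (hne q hq)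
          (hne r hr) (h.matchable_of_rewire (by grind)) }⟩

lemma exists_rootedRestValues (h : TwoEnd G C K W a b) (hIH : HasRootedWeights V C.card) {j : V}
    (hj : j ∈ W) : ∃ y R, RootedRestValues G C W a b j y R := by
  have haW := h.left_notMem_rest
  obtain ⟨y, hy⟩ := hIH _ (insert a W) j h.card_insert_lt h.factorCritical_rewire
    h.three_le_card_insert (by simp [hj])
  have hne : ∀ w ∈ W, w ≠ a := fun w hw => ne_of_mem_of_not_mem hw haW
  have hne' : ∀ w ∈ W.erase j, w ≠ a := fun w hw => hne w (mem_of_mem_erase hw)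
  have hmem : ∀ w ∈ W.erase j, w ∈ (insert a W).erase j := by grind
  have ha : a ∈ (insert a W).erase j := by grind
  exact ⟨y, y a,
    { lower := fun w hw => hy.lower w (by simp [hw])
      upper := fun w hw => hy.upper w (by simp [hw])
      root := hy.root
      lower_attach := hy.lower a (by simp)
      upper_attach := hy.upper a (by simp)
      total := by
        have := hy.total
        rw [sum_insert haW] at this
        omega
      edge := fun w hw hadj => hy.edge w (by simp [hw]) ((rewire_adj (hne j hj) (hne w hw)).2 hadj)
      edge_attach := fun hadj => hy.edge a (by simp) ((rewire_adj_left (hne j hj)).2 hadj).symm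
      pair := fun p hp q hq hpq hflat => hy.pair p (hmem p hp) q (hmem q hq)
        ((rewire_adj (hne' p hp) (hne' q hq)).2 hpq) fun hm =>
          hflat (h.matchable_of_rewire (by grind) hm)
      pair_attach := fun w hw hadj hflat => hy.pair a ha w (hmem w hw)
        ((rewire_adj_left (hne' w hw)).2 hadj) fun hm =>
          hflat (((matchable_rewire_iff (by simp)).1 hm).congr (by grind))
      triangle := fun p hp q hq r hr =>
        (hy.triangle p (hmem p hp) q (hmem q hq) r (hmem r hr)).of_rewire (hne' p hp) (hne' q hq)
          (hne' r hr) (h.matchable_of_rewire (by grind))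
      triangle_attach := fun p hp q hq hpq hap haq hflat =>
        hy.triangle a ha p (hmem p hp) q (hmem q hq) ((rewire_adj_left (hne' p hp)).2 hap)
          ((rewire_adj (hne' p hp) (hne' q hq)).2 hpq) ((rewire_adj_left (hne' q hq)).2 haq)
          fun hm => hflat (((matchable_rewire_iff (by simp)).1 hm).congr (by grind)) }⟩

end TwoEnd

/-- The weight equal to `yK` on `K`, `α` at `a`, `β` at `b` and `yW` elsewhere, which combines
weights on an end attached at `a` and `b` and on the part beyond it. -/
def glue (K : Finset V) (a b : V) (yK : V → ℤ) (α β : ℤ) (yW : V → ℤ) : V → ℤ :=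
  fun v => if v ∈ K then yK v else if v = a then α else if v = b then β else yW v

/-- The position of a vertex in the order `K`, `a`, `b`, `W`. Bounds on edges and triangles are
invariant under permutations, so they need only be checked for vertices of increasing rank. -/
def rank (K : Finset V) (a b : V) (v : V) : ℕ :=
  if v ∈ K then 0 else if v = a then 1 else if v = b then 2 else 3

lemma glue_of_mem {K : Finset V} {a b v : V} {yK yW : V → ℤ} {α β : ℤ} (hv : v ∈ K) :
    glue K a b yK α β yW v = yK v := by
  simp [glue, hv]

lemma rank_of_mem {K : Finset V} {a b v : V} (hv : v ∈ K) : rank K a b v = 0 := by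
  simp [rank, hv]

namespace TwoEnd

variable {C K W : Finset V} {a b : V} {yK yW : V → ℤ} {α β : ℤ}

lemma glue_left (h : TwoEnd G C K W a b) : glue K a b yK α β yW a = α := by
  simp [glue, h.left_notMem]

lemma glue_right (h : TwoEnd G C K W a b) : glue K a b yK α β yW b = β := by
  simp [glue, h.right_notMem, h.ne.symm]

lemma glue_rest (h : TwoEnd G C K W a b) {w : V} (hw : w ∈ W) :
    glue K a b yK α β yW w = yW w := by
  simp [glue, h.mem_rest.1 hw]

lemma rank_left (h : TwoEnd G C K W a b) : rank K a b a = 1 := by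
  simp [rank, h.left_notMem]

lemma rank_right (h : TwoEnd G C K W a b) : rank K a b b = 2 := by
  simp [rank, h.right_notMem, h.ne.symm]

lemma rank_rest (h : TwoEnd G C K W a b) {w : V} (hw : w ∈ W) : rank K a b w = 3 := by
  simp [rank, h.mem_rest.1 hw]

lemma sum_glue (h : TwoEnd G C K W a b) :
    ∑ v ∈ C, glue K a b yK α β yW v = ∑ k ∈ K, yK k + α + β + ∑ w ∈ W, yW w := by
  rw [h.eq_insert, sum_insert h.left_notMem_insert, sum_insert h.right_notMem_union,
    sum_union h.disjoint_rest, h.glue_left, h.glue_right, sum_congr rfl fun v => glue_of_mem,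
    sum_congr rfl fun v => h.glue_rest]
  ring

lemma le_glue (h : TwoEnd G C K W a b) {m : ℤ} (hK : ∀ k ∈ K, m ≤ yK k) (hα : m ≤ α) (hβ : m ≤ β)
    (hW : ∀ w ∈ W, m ≤ yW w) : ∀ v ∈ C, m ≤ glue K a b yK α β yW v := by
  intro v hv
  rcases h.cases hv with hv | rfl | rfl | hv
  · rw [glue_of_mem hv]
    exact hK v hv
  · rwa [h.glue_left]
  · rwa [h.glue_right]
  · rw [h.glue_rest hv]
    exact hW v hv

lemma glue_le (h : TwoEnd G C K W a b) {m : ℤ} (hK : ∀ k ∈ K, yK k ≤ m) (hα : α ≤ m) (hβ : β ≤ m)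
    (hW : ∀ w ∈ W, yW w ≤ m) : ∀ v ∈ C, glue K a b yK α β yW v ≤ m := by
  intro v hv
  rcases h.cases hv with hv | rfl | rfl | hv
  · rw [glue_of_mem hv]
    exact hK v hv
  · rwa [h.glue_left]
  · rwa [h.glue_right]
  · rw [h.glue_rest hv]
    exact hW v hv

lemma triangleBound_glue (h : TwoEnd G C K W a b) {D : Finset V} (hD : D ⊆ C)
    (hKKK : ∀ p ∈ K, ∀ q ∈ K, ∀ r ∈ K, TriangleBound G C yK p q r)
    (hKKa : ∀ p ∈ K, ∀ q ∈ K, G.Adj p q → ¬ Matchable G (C \ {p, q, a}) → yK p + yK q + α ≤ 0)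
    (hKKb : ∀ p ∈ K, ∀ q ∈ K, G.Adj p q → G.Adj b p → G.Adj b q → ¬ Matchable G (C \ {p, q, b}) →
      yK p + yK q + β ≤ 0)
    (habW : ∀ w ∈ D, w ∈ W → G.Adj a w → G.Adj b w → α + β + yW w ≤ 0)
    (hWW : ∀ p ∈ D, ∀ q ∈ D, p ∈ W → q ∈ W → G.Adj p q → p ∈ jointNbr G a b → q ∈ jointNbr G a b →
      ¬ Matchable G (W \ {p, q}) → max α β + yW p + yW q ≤ 0)
    (hWWW : ∀ p ∈ D, ∀ q ∈ D, ∀ r ∈ D, p ∈ W → q ∈ W → r ∈ W → TriangleBound G C yW p q r) :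
    ∀ p ∈ D, ∀ q ∈ D, ∀ r ∈ D, TriangleBound G C (glue K a b yK α β yW) p q r := by
  refine triangleBound_of_sorted (rank K a b) ?_
  intro p hp q hq r hr hle_pq hle_qr hpq hqr hpr hflat
  rcases h.cases (hD hp) with hpc | rfl | rfl | hpc <;>
    rcases h.cases (hD hq) with hqc | rfl | rfl | hqc <;>
    rcases h.cases (hD hr) with hrc | rfl | rfl | hrc <;>
    (try simp only [rank_of_mem, h.rank_left, h.rank_right, h.rank_rest, *] at hle_pq hle_qr) <;>
    (try (exfalso; omega)) <;> (try exact absurd hqr (h.not_adj hqc hrc)) <;>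
    (try exact absurd hpr (h.not_adj hpc hrc)) <;> (try exact absurd rfl hpq.ne) <;>
    (try exact absurd rfl hqr.ne)
  · rw [glue_of_mem hpc, glue_of_mem hqc, glue_of_mem hrc]
    exact hKKK p hpc q hqc r hrc hpq hqr hpr hflat
  · rw [glue_of_mem hpc, glue_of_mem hqc, h.glue_left]
    exact hKKa p hpc q hqc hpq hflat
  · rw [glue_of_mem hpc, glue_of_mem hqc, h.glue_right]
    exact hKKb p hpc q hqc hpq hpr.symm hqr.symm hflat
  · exact absurd (h.isEnd.matchable_sdiff_pair hpc (by simp) (by simp) h.ne) hflat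
  · rw [h.glue_left, h.glue_right, h.glue_rest hrc]
    exact habW r hr hrc hpr hqr
  · rw [h.glue_left, h.glue_rest hqc, h.glue_rest hrc]
    have := hWW q hq r hr hqc hrc hqr (.inl hpq) (.inl hpr) fun hm =>
      hflat (h.matchable_sdiff_insert (by grind) hm)
    omega
  · rw [h.glue_right, h.glue_rest hqc, h.glue_rest hrc]
    have := hWW q hq r hr hqc hrc hqr (.inr hpq) (.inr hpr) fun hm =>
      hflat (h.symm.matchable_sdiff_insert (by grind) hm)
    omega
  · rw [h.glue_rest hpc, h.glue_rest hqc, h.glue_rest hrc]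
    exact hWWW p hp q hq r hr hpc hqc hrc hpq hqr hpr hflat

lemma pairBound_glue (h : TwoEnd G C K W a b) {j : V}
    (hKK : ∀ p ∈ K, ∀ q ∈ K, PairBound G C j yK p q)
    (hKa : ∀ k ∈ K, G.Adj a k → yK k + α ≤ 0)
    (hKb : ∀ k ∈ K, ¬ Matchable G (C \ {j, k, b}) → yK k + β ≤ 0) (hab : α + β ≤ 0)
    (haW : ∀ w ∈ W.erase j, G.Adj a w → ¬ Matchable G (C \ {j, a, w}) → α + yW w ≤ 0)
    (hbW : ∀ w ∈ W.erase j, G.Adj b w → β + yW w ≤ 0)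
    (hWW : ∀ p ∈ W.erase j, ∀ q ∈ W.erase j, PairBound G C j yW p q) :
    ∀ p ∈ C.erase j, ∀ q ∈ C.erase j, PairBound G C j (glue K a b yK α β yW) p q := by
  refine pairBound_of_sorted (rank K a b) ?_
  intro p hp q hq hle hpq hflat
  obtain ⟨hpj, hp⟩ := mem_erase.1 hp
  obtain ⟨hqj, hq⟩ := mem_erase.1 hq
  rcases h.cases hp with hpc | rfl | rfl | hpc <;>
    rcases h.cases hq with hqc | rfl | rfl | hqc <;>
    (try simp only [rank_of_mem, h.rank_left, h.rank_right, h.rank_rest, *] at hle) <;>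
    (try (exfalso; omega)) <;> (try exact absurd hpq (h.not_adj hpc hqc)) <;>
    (try exact absurd rfl hpq.ne)
  · rw [glue_of_mem hpc, glue_of_mem hqc]
    exact hKK p hpc q hqc hpq hflat
  · rw [glue_of_mem hpc, h.glue_left]
    exact hKa p hpc hpq.symm
  · rw [glue_of_mem hpc, h.glue_right]
    exact hKb p hpc hflat
  · rwa [h.glue_left, h.glue_right]
  · rw [h.glue_left, h.glue_rest hqc]
    exact haW q (mem_erase.2 ⟨hqj, hqc⟩) hpq hflat
  · rw [h.glue_right, h.glue_rest hqc]
    exact hbW q (mem_erase.2 ⟨hqj, hqc⟩) hpq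
  · rw [h.glue_rest hpc, h.glue_rest hqc]
    exact hWW p (mem_erase.2 ⟨hpj, hpc⟩) q (mem_erase.2 ⟨hqj, hqc⟩) hpq hflat

lemma triangleBound_glue_endValues (h : TwoEnd G C K W a b) {A B : ℤ}
    (hK : EndValues G C K {a, b} b yK A B) (hα : α ≤ 0) (hβ : β ≤ B) {D : Finset V} (hD : D ⊆ C)
    (habW : ∀ w ∈ D, w ∈ W → G.Adj a w → G.Adj b w → α + β + yW w ≤ 0)
    (hWW : ∀ p ∈ D, ∀ q ∈ D, p ∈ W → q ∈ W → G.Adj p q → p ∈ jointNbr G a b → q ∈ jointNbr G a b →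
      ¬ Matchable G (W \ {p, q}) → max α β + yW p + yW q ≤ 0)
    (hWWW : ∀ p ∈ D, ∀ q ∈ D, ∀ r ∈ D, p ∈ W → q ∈ W → r ∈ W → TriangleBound G C yW p q r) :
    ∀ p ∈ D, ∀ q ∈ D, ∀ r ∈ D, TriangleBound G C (glue K a b yK α β yW) p q r := by
  refine h.triangleBound_glue hD hK.triangle ?_ ?_ habW hWW hWWW
  · intro p hp q hq hpq hflat
    have := hK.pair p hp q hq hpq fun k hk hkp hkq => h.isEnd.not_matchable_of_cross hp hq
      (by simp) hflat k hk hkp hkq b (by simp) h.ne.symm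
    omega
  · intro p hp q hq hpq hbp hbq hflat
    have := hK.pair_right p hp q hq hpq hbp hbq
      (h.isEnd.not_matchable_of_cross hp hq (by simp) hflat)
    omega

end TwoEnd

namespace TwoEnd

variable {C K W : Finset V} {a b j : V} {yK yW : V → ℤ} {A B R : ℤ}

lemma card_lt (h : TwoEnd G C K W a b) : K.card + 2 < C.card := by
  have := h.card_eq
  have := card_pos.2 h.nonempty
  omega

lemma exists_endValues (h : TwoEnd G C K W a b) (hIH : HasRootedWeights V C.card) :
    ∃ y A B, EndValues G C K {a, b} b y A B :=
  h.isEnd.exists_endValues hIH h.card_lt (a := a) (by simp) (by simp) h.ne h.adj_right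
    ⟨a, by simp, h.ne, h.adj_left⟩

lemma triangleBound_glue_restValues (h : TwoEnd G C K W a b)
    (hK : EndValues G C K {a, b} b yK A B) (hW : RestValues G C W a b yW R) {α β : ℤ}
    (hα : α ≤ 0) (hβ : β ≤ B) (hβ0 : β ≤ 0) (hadd : α + β ≤ R) :
    ∀ p ∈ C, ∀ q ∈ C, ∀ r ∈ C, TriangleBound G C (glue K a b yK α β yW) p q r := by
  refine h.triangleBound_glue_endValues hK hα hβ Subset.rfl ?_ ?_ ?_
  · intro w _ hw haw _
    have := hW.edge w hw (.inl haw)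
    omega
  · intro p _ q _ hp hq hpq _ _ hflat
    have := hW.pair p hp q hq hpq hflat
    omega
  · exact fun p _ q _ r _ hp hq hr => hW.triangle p hp q hq r hr

lemma pairBound_glue_restValues (h : TwoEnd G C K W a b)
    (hK : EndValues G C K {a, b} b yK A B) (hW : RestValues G C W a b yW R) :
    ∀ p ∈ C.erase a, ∀ q ∈ C.erase a,
      PairBound G C a (glue K a b yK (min A R) (min B R) yW) p q := by
  have hAB := hK.add_le
  refine h.pairBound_glue ?_ ?_ ?_ (by omega) ?_ ?_ ?_
  · intro p hp q hq hpq hflat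
    refine hK.pair p hp q hq hpq fun k hk hkp hkq hadj => ?_
    exact h.isEnd.not_matchable_of_cross hp hq (by simp) (fun hm => hflat (hm.congr (by grind)))
      k hk hkp hkq b (by simp) h.ne.symm hadj
  · intro k hk hadj
    have := hK.edge k hk a (by simp) h.ne hadj
    omega
  · intro k hk hflat
    exact absurd ((h.isEnd.matchable_sdiff_pair (x := a) (x' := b) hk (by simp) (by simp)
      h.ne).congr (by grind)) hflat
  · intro w hw hadj _
    have := hW.edge w (mem_of_mem_erase hw) (.inl hadj)
    omega
  · intro w hw hadj
    have := hW.edge w (mem_of_mem_erase hw) (.inr hadj)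
    omega
  · intro p hp q hq hpq hflat
    exact hW.pair p (mem_of_mem_erase hp) q (mem_of_mem_erase hq) hpq fun hm =>
      hflat (h.matchable_sdiff_insert (by grind) hm)

lemma exists_rootedWeight_left (h : TwoEnd G C K W a b) (hIH : HasRootedWeights V C.card) :
    ∃ y, RootedWeight G C a y := by
  obtain ⟨yK, A, B, hK⟩ := h.exists_endValues hIH
  obtain ⟨yW, R, hW⟩ := h.exists_restValues hIH
  have hA := hK.lower_left
  have hA0 := hK.upper_left
  have hB := hK.lower_right
  have hAB := hK.add_le
  have hR := hW.lower_root
  have hR0 := hW.upper_root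
  refine ⟨glue K a b yK (min A R) (min B R) yW,
    { lower := h.le_glue hK.lower (by omega) (by omega) hW.lower
      upper := h.glue_le hK.upper (by omega) (by omega) hW.upper
      root := by
        rw [h.glue_left]
        omega
      total := by
        have := hK.total
        have := hW.total
        rw [h.sum_glue]
        omega
      edge := fun k hk hadj => ?_
      pair := h.pairBound_glue_restValues hK hW
      triangle := fun p hp q hq r hr => h.triangleBound_glue_restValues hK hW (by omega)
        (by omega) (by omega) (by omega) p (mem_of_mem_erase hp) q (mem_of_mem_erase hq) r
        (mem_of_mem_erase hr) }⟩
  rw [h.glue_left]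
  rcases h.cases hk with hk | rfl | rfl | hk
  · rw [glue_of_mem hk]
    have := hK.edge k hk a (by simp) h.ne hadj
    omega
  · exact absurd rfl hadj.ne
  · rw [h.glue_right]
    omega
  · rw [h.glue_rest hk]
    have := hW.edge k hk (.inl hadj)
    omega

lemma exists_rootedWeight_of_mem (h : TwoEnd G C K W a b) (hIH : HasRootedWeights V C.card)
    (hj : j ∈ K) (hm : ∀ p ∈ C.erase j, ∀ q ∈ C.erase j, G.Adj p q → Matchable G (C \ {j, p, q})) :
    ∃ y, RootedWeight G C j y := by
  obtain ⟨yW, R, hW⟩ := h.exists_restValues hIH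
  have hR := hW.lower_root
  have hR0 := hW.upper_root
  have htriangle : ∀ p ∈ C, ∀ q ∈ C, ∀ r ∈ C, TriangleBound G C (glue K a b 0 R 0 yW) p q r := by
    refine h.triangleBound_glue Subset.rfl ?_ ?_ ?_ ?_ ?_ ?_
    · exact fun _ _ _ _ _ _ _ _ _ _ => by simp
    · exact fun _ _ _ _ _ _ => by simpa using hR0
    · exact fun _ _ _ _ _ _ _ _ => by simp
    · intro w _ hw haw _
      have := hW.edge w hw (.inl haw)
      omega
    · intro p _ q _ hp hq hpq _ _ hflat
      have := hW.pair p hp q hq hpq hflat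
      omega
    · exact fun p _ q _ r _ hp hq hr => hW.triangle p hp q hq r hr
  refine ⟨glue K a b 0 R 0 yW,
    { lower := h.le_glue (by simp) (by omega) (by omega) hW.lower
      upper := h.glue_le (by simp) (by omega) (by omega) hW.upper
      root := by simp [glue_of_mem hj]
      total := by
        have := hW.total
        simp only [h.sum_glue, Pi.zero_apply, sum_const_zero]
        omega
      edge := fun k hk hadj => ?_
      pair := fun p hp q hq hpq hflat => absurd (hm p hp q hq hpq) hflat
      triangle := fun p hp q hq r hr => htriangle p (mem_of_mem_erase hp) q (mem_of_mem_erase hq) r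
        (mem_of_mem_erase hr) }⟩
  rw [glue_of_mem hj]
  rcases h.cases hk with hk | rfl | rfl | hk
  · simp [glue_of_mem hk]
  · simpa [h.glue_left] using hR0
  · simp [h.glue_right]
  · exact absurd hadj (h.not_adj hj hk)

lemma not_matchable_of_rest (h : TwoEnd G C K W a b) (hj : j ∈ W)
    (ha : Matchable G (insert a (W.erase j))) {p q : V} (hp : p ∈ K) (hq : q ∈ K)
    (hflat : ¬ Matchable G (C \ {j, p, q})) :
    ∀ k ∈ K, k ≠ p → k ≠ q → G.Adj b k → ¬ Matchable G (K \ {k, p, q}) := by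
  intro k hk hkp hkq hadj hm
  have hmem := fun v => h.mem_rest (v := v)
  have hj' := (hmem j).1 hj
  have haC := h.left_mem
  have haK := h.left_notMem
  have hbK := h.right_notMem
  have hab := h.ne
  refine hflat (h.isEnd.matchable_of_cross (x := b) hk (by simp) hadj (hm.congr ?_) ?_ ?_
    (ha.congr fun v => ?_))
  · grind
  · grind
  · grind
  · simp only [mem_sdiff, mem_insert, mem_singleton, mem_erase, hmem]
    grind

lemma matchable_sdiff_of_rest (h : TwoEnd G C K W a b) {k : V} (hj : j ∈ W)
    (ha : Matchable G (insert a (W.erase j))) (hk : k ∈ K) : Matchable G (C \ {j, k, b}) := by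
  have hmem := fun v => h.mem_rest (v := v)
  have hj' := (hmem j).1 hj
  have haC := h.left_mem
  have haK := h.left_notMem
  have hbK := h.right_notMem
  have hab := h.ne
  have hKC : ∀ v ∈ K, v ∈ C := h.isEnd.subset
  refine (h.isEnd.factorCritical.2 k hk).of_parts ha (fun v => ?_) fun v => ?_
  · simp only [mem_sdiff, mem_insert, mem_singleton, mem_erase, hmem]
    grind
  · simp only [mem_insert, mem_erase, hmem]
    grind

lemma exists_rootedWeight_of_matchable_of_matchable (h : TwoEnd G C K W a b)
    (hIH : HasRootedWeights V C.card) (hj : j ∈ W) (ha : Matchable G (insert a (W.erase j)))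
    (hb : Matchable G (insert b (W.erase j))) : ∃ y, RootedWeight G C j y := by
  obtain ⟨y, A, B, hK⟩ := h.exists_endValues hIH
  obtain ⟨z, hz⟩ := hK.exists_endWeight h.isEnd (by simp)
  have hj' := h.mem_rest.1 hj
  have hjz : z j = 0 := hz.zero j hj'.2.1 hj'.2.2.2
  refine ⟨z, fun v _ => hz.lower v, fun v _ => hz.upper v, hjz.le, hz.total, ?_, ?_, ?_⟩
  · intro k _ hadj
    have := hz.nonpos k fun hkK => h.not_adj hkK hj hadj.symm
    omega
  · refine pairBound_of_sorted (fun v => if v ∈ K then 0 else 1) ?_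
    intro p _ q hq hle hpq hflat
    by_cases hpK : p ∈ K
    swap
    · have := hz.nonpos p hpK
      have := hz.nonpos q fun hq => by simp [hpK, hq] at hle
      omega
    by_cases hqK : q ∈ K
    · exact hz.pair p hpK q hqK hpq (h.not_matchable_of_rest hj ha hpK hqK hflat)
    have hqX := (h.isEnd.mem_or_mem p hpK q (mem_of_mem_erase hq) hpq).resolve_left hqK
    rcases mem_insert.1 hqX with rfl | hqb
    · exact absurd (h.symm.matchable_sdiff_of_rest hj hb hpK) hflat
    · rw [mem_singleton.1 hqb] at hflat
      exact absurd (h.matchable_sdiff_of_rest hj ha hpK) hflat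
  · exact fun p hp q hq r hr => hz.triangle p (mem_of_mem_erase hp) q (mem_of_mem_erase hq) r
      (mem_of_mem_erase hr)

lemma add_le_of_not_matchable (h : TwoEnd G C K W a b) (hW : RootedRestValues G C W a b j yW R)
    (hb : ¬ Matchable G (insert b (W.erase j))) {w : V} (hw : w ∈ W.erase j) (hadj : G.Adj b w) :
    R + yW w ≤ 0 := by
  have hbW := h.right_notMem_rest
  refine hW.pair_attach w hw (.inr hadj) fun hm => hb ?_
  refine (matchable_pair hadj).of_parts hm ?_ ?_ <;> grind

lemma pairBound_glue_rootedRestValues (h : TwoEnd G C K W a b)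
    (hK : EndValues G C K {a, b} b yK A B) (hW : RootedRestValues G C W a b j yW R) (hj : j ∈ W)
    (ha : Matchable G (insert a (W.erase j))) (hb : ¬ Matchable G (insert b (W.erase j))) :
    ∀ p ∈ C.erase j, ∀ q ∈ C.erase j,
      PairBound G C j (glue K a b yK (min A R) (min B R) yW) p q := by
  have hAB := hK.add_le
  refine h.pairBound_glue ?_ ?_ ?_ (by omega) ?_ ?_ hW.pair
  · exact fun p hp q hq hpq hflat =>
      hK.pair p hp q hq hpq (h.not_matchable_of_rest hj ha hp hq hflat)
  · intro k hk hadj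
    have := hK.edge k hk a (by simp) h.ne hadj
    omega
  · exact fun k hk hflat => absurd (h.matchable_sdiff_of_rest hj ha hk) hflat
  · intro w hw hadj hflat
    have := hW.pair_attach w hw (.inl hadj) fun hm => hflat <|
      (h.matchable_sdiff_insert (T := {j, w}) (by grind) hm).congr (by grind)
    omega
  · intro w hw hadj
    have := h.add_le_of_not_matchable hW hb hw hadj
    omega

lemma triangleBound_glue_rootedRestValues (h : TwoEnd G C K W a b)
    (hK : EndValues G C K {a, b} b yK A B) (hW : RootedRestValues G C W a b j yW R)
    (hb : ¬ Matchable G (insert b (W.erase j))) :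
    ∀ p ∈ C.erase j, ∀ q ∈ C.erase j, ∀ r ∈ C.erase j,
      TriangleBound G C (glue K a b yK (min A R) (min B R) yW) p q r := by
  have hA := hK.upper_left
  have hne : ∀ v ∈ C.erase j, v ∈ W → v ∈ W.erase j := by grind
  refine h.triangleBound_glue_endValues hK (by omega) (by omega) (erase_subset _ _) ?_ ?_ ?_
  · intro w hwC hw _ hadj
    have := h.add_le_of_not_matchable hW hb (hne w hwC hw) hadj
    omega
  · intro p hpC q hqC hp hq hpq hap haq hflat
    have := hW.triangle_attach p (hne p hpC hp) q (hne q hqC hq) hpq hap haq hflat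
    omega
  · exact fun p hpC q hqC r hrC hp hq hr =>
      hW.triangle p (hne p hpC hp) q (hne q hqC hq) r (hne r hrC hr)

lemma exists_rootedWeight_of_matchable_of_not_matchable (h : TwoEnd G C K W a b)
    (hIH : HasRootedWeights V C.card) (hj : j ∈ W) (ha : Matchable G (insert a (W.erase j)))
    (hb : ¬ Matchable G (insert b (W.erase j))) : ∃ y, RootedWeight G C j y := by
  obtain ⟨yK, A, B, hK⟩ := h.exists_endValues hIH
  obtain ⟨yW, R, hW⟩ := h.exists_rootedRestValues hIH hj
  have hA := hK.lower_left
  have hA0 := hK.upper_left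
  have hB := hK.lower_right
  have hB1 := hK.upper_right
  have hAB := hK.add_le
  have hR := hW.lower_attach
  have hR1 := hW.upper_attach
  have hroot := hW.root
  refine ⟨glue K a b yK (min A R) (min B R) yW,
    { lower := h.le_glue hK.lower (by omega) (by omega) hW.lower
      upper := h.glue_le hK.upper (by omega) (by omega) hW.upper
      root := by rwa [h.glue_rest hj]
      total := by
        have := hK.total
        have := hW.total
        rw [h.sum_glue]
        omega
      edge := fun k hk hadj => ?_
      pair := h.pairBound_glue_rootedRestValues hK hW hj ha hb
      triangle := h.triangleBound_glue_rootedRestValues hK hW hb }⟩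
  rw [h.glue_rest hj]
  rcases h.cases hk with hk | rfl | rfl | hk
  · exact absurd hadj.symm (h.not_adj hk hj)
  · rw [h.glue_left]
    omega
  · rw [h.glue_right]
    have := hW.edge_attach (.inr hadj.symm)
    omega
  · rw [h.glue_rest hk]
    exact hW.edge k hk hadj

lemma exists_rootedWeight_of_notMem (h : TwoEnd G C K W a b)
    (hIH : HasRootedWeights V C.card) (hj : j ∈ C) (hjK : j ∉ K) :
    ∃ y, RootedWeight G C j y := by
  rcases h.cases hj with hj | rfl | rfl | hj
  · exact absurd hj hjK
  · exact h.exists_rootedWeight_left hIH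
  · exact h.symm.exists_rootedWeight_left hIH
  · by_cases ha : Matchable G (insert a (W.erase j)) <;>
      by_cases hb : Matchable G (insert b (W.erase j))
    · exact h.exists_rootedWeight_of_matchable_of_matchable hIH hj ha hb
    · exact h.exists_rootedWeight_of_matchable_of_not_matchable hIH hj ha hb
    · exact h.symm.exists_rootedWeight_of_matchable_of_not_matchable hIH hj hb ha
    · exact ((h.exists_attach hj).elim ha hb).elim

lemma exists_excessWeight (h : TwoEnd G C K W a b) (hIH : HasRootedWeights V C.card) :
    ∃ y, ExcessWeight G C y := by
  obtain ⟨yK, A, B, hK⟩ := h.exists_endValues hIH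
  obtain ⟨yW, R, hW⟩ := h.exists_restValues hIH
  have hR := hW.upper_root
  refine ⟨glue K a b yK R (min B 0) yW, h.glue_le hK.upper (by omega) (by omega) hW.upper, ?_,
    h.triangleBound_glue_restValues hK hW hR (by omega) (by omega) (by omega)⟩
  have := hK.upper_left
  have := hK.add_le
  have := hK.total
  have := hW.total
  rw [h.sum_glue]
  omega

end TwoEnd

/-- A weight on `C` supported on two ends with common attachments `X`, and lowered to `-1` at the
attachment `g`. -/
structure LoweredWeight (G : SimpleGraph V) (C K₁ K₂ X : Finset V) (g : V) (z : V → ℤ) : Prop where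
  lower : ∀ v, -1 ≤ z v
  upper : ∀ v, z v ≤ 1
  nonpos : ∀ v, v ∉ K₁ → v ∉ K₂ → z v ≤ 0
  gate : z g = -1
  total : 1 ≤ ∑ v ∈ C, z v
  triangle : ∀ p ∈ C, ∀ q ∈ C, ∀ r ∈ C, TriangleBound G C z p q r
  pair_left : ∃ b ∈ X, b ≠ g ∧ EndPairBound G K₁ b z
  pair_right : ∃ b ∈ X, b ≠ g ∧ EndPairBound G K₂ b z

namespace EndWeight

variable {C K K₁ K₂ X : Finset V} {b b₁ b₂ g : V} {z z₁ z₂ : V → ℤ}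

lemma zero_of_isEnd (hz : EndWeight G C K₁ b z) (h : IsEnd G C K₂ X) (hd : Disjoint K₁ K₂)
    (hb : b ∈ X) {v : V} (hv : v ∈ K₂) : z v = 0 :=
  hz.zero v (Finset.disjoint_right.1 hd hv) fun hvb => h.notMem b hb (hvb ▸ hv)

lemma triangleBound_add (hz₁ : EndWeight G C K₁ b₁ z₁) (hz₂ : EndWeight G C K₂ b₂ z₂)
    {z : V → ℤ} (hle : ∀ v, z v ≤ z₁ v + z₂ v) :
    ∀ p ∈ C, ∀ q ∈ C, ∀ r ∈ C, TriangleBound G C z p q r := by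
  intro p hp q hq r hr hpq hqr hpr hflat
  have := hz₁.triangle p hp q hq r hr hpq hqr hpr hflat
  have := hz₂.triangle p hp q hq r hr hpq hqr hpr hflat
  have := hle p
  have := hle q
  have := hle r
  omega

lemma excessWeight_add (hz₁ : EndWeight G C K₁ b₁ z₁) (hz₂ : EndWeight G C K₂ b₂ z₂)
    (hd : Disjoint K₁ K₂) : ExcessWeight G C fun v => z₁ v + z₂ v where
  upper v _ := by
    have := hz₁.upper v
    have := hz₂.upper v
    by_cases hv : v ∈ K₁
    · have := hz₂.nonpos v (Finset.disjoint_left.1 hd hv)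
      omega
    · have := hz₁.nonpos v hv
      omega
  total := by
    rw [sum_add_distrib]
    have := hz₁.total
    have := hz₂.total
    omega
  triangle := hz₁.triangleBound_add hz₂ fun _ => le_rfl

lemma loweredWeight (hz₁ : EndWeight G C K₁ b₁ z₁) (hz₂ : EndWeight G C K₂ b₂ z₂)
    (h : TwoEnds G C K₁ K₂ X) (hb₁ : b₁ ∈ X) (hb₂ : b₂ ∈ X) (hg : g ∈ X) (hb₁g : b₁ ≠ g)
    (hb₂g : b₂ ≠ g) (hne : b₁ ≠ b₂) :
    LoweredWeight G C K₁ K₂ X g fun v => z₁ v + z₂ v + if v = g then -1 else 0 := by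
  have hg₁ : g ∉ K₁ := h.left.notMem g hg
  have hg₂ : g ∉ K₂ := h.right.notMem g hg
  have hzero₂ : ∀ v ∈ K₁, z₂ v = 0 := fun v =>
    hz₂.zero_of_isEnd h.left h.disjoint.symm hb₂
  have hzero₁ : ∀ v ∈ K₂, z₁ v = 0 := fun v => hz₁.zero_of_isEnd h.right h.disjoint hb₁
  refine
    { lower := fun v => ?_
      upper := fun v => ?_
      nonpos := fun v hv₁ hv₂ => ?_
      gate := ?_
      total := ?_
      triangle := hz₁.triangleBound_add hz₂ fun v => by grind
      pair_left := ⟨b₁, hb₁, hb₁g, fun p hp q hq hpq hno => ?_⟩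
      pair_right := ⟨b₂, hb₂, hb₂g, fun p hp q hq hpq hno => ?_⟩ }
  · have := hz₁.lower v
    have := hz₂.lower v
    have := hz₁.zero v
    have := hz₂.zero v
    by_cases v ∈ K₁ <;> by_cases v ∈ K₂ <;> by_cases v = b₁ <;> grind
  · have := hz₁.upper v
    have := hz₂.upper v
    have := hz₁.nonpos v
    have := hz₂.nonpos v
    by_cases v ∈ K₁ <;> by_cases v ∈ K₂ <;> grind
  · have := hz₁.nonpos v hv₁
    have := hz₂.nonpos v hv₂
    grind
  · simp [hz₁.zero g hg₁ hb₁g.symm, hz₂.zero g hg₂ hb₂g.symm]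
  · rw [sum_add_distrib, sum_add_distrib, sum_ite_eq' C g,
      if_pos (h.left.attachment_subset hg)]
    have := hz₁.total
    have := hz₂.total
    omega
  · have := hz₁.pair p hp q hq hpq hno
    grind
  · have := hz₂.pair p hp q hq hpq hno
    grind

end EndWeight

namespace IsEnd

variable {C K X : Finset V} {b g j : V} {z : V → ℤ}

lemma eq_gate (h : IsEnd G C K X) (hj : j ∈ C) (hjK : j ∉ K)
    (hm : ∀ x ∈ X, x ≠ g → Matchable G ((C \ K) \ {j, x})) (hjX : j ∈ X) : j = g := by
  by_contra hne
  have hodd := (hm j hjX hne).even_card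
  have hmem : j ∈ C \ K := mem_sdiff.2 ⟨hj, hjK⟩
  rw [pair_eq_singleton, sdiff_singleton_eq_erase, ← Nat.not_odd_iff_even] at hodd
  refine hodd ?_
  have heven := h.matchable.even_card
  rwa [← card_erase_add_one hmem, Nat.even_add_one, Nat.not_even_iff_odd] at heven

lemma pairBound_of_gate (h : IsEnd G C K X) (hj : j ∈ C) (hjK : j ∉ K)
    (hm : ∀ x ∈ X, x ≠ g → Matchable G ((C \ K) \ {j, x})) (hup : ∀ v, z v ≤ 1) (hg : z g = -1)
    (hb : ∃ b ∈ X, b ≠ g ∧ EndPairBound G K b z) :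
    ∀ p ∈ K, ∀ q ∈ C.erase j, PairBound G C j z p q := by
  intro p hp q hq hpq hflat
  have hXK := h.notMem
  have hKC : ∀ v ∈ K, v ∈ C := h.subset
  by_cases hqK : q ∈ K
  · obtain ⟨b, hbX, hbg, hz⟩ := hb
    refine hz p hp q hqK hpq fun k hk hkp hkq hadj hmatch => hflat ?_
    have hbj : b ≠ j := by
      rintro rfl
      exact hbg (h.eq_gate hj hjK hm hbX)
    have := hXK b hbX
    refine h.matchable_of_cross hk hbX hadj (hmatch.congr ?_) ?_ ?_
      ((hm b hbX hbg).congr fun v => ?_)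
    · grind
    · grind
    · grind
    · simp only [mem_sdiff, mem_insert, mem_singleton]
      grind
  have hqX := (h.mem_or_mem p hp q (mem_of_mem_erase hq) hpq).resolve_left hqK
  rcases eq_or_ne q g with rfl | hqg
  · have := hup p
    omega
  · refine absurd ((h.factorCritical.2 p hp).of_parts (hm q hqX hqg) (fun v => ?_) ?_) hflat
    · simp only [mem_sdiff, mem_insert, mem_singleton, mem_erase]
      grind
    · grind

lemma exists_rootedWeight_of_matchable (h : IsEnd G C K X) (hIH : HasRootedWeights V C.card)
    (h3 : 3 ≤ (nbr G X {K}).card) (hj : j ∈ C) (hjK : j ∉ K) (hjX : j ∉ X)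
    (hm : ∀ p ∈ C.erase j, ∀ q ∈ C.erase j, G.Adj p q → Matchable G (C \ {j, p, q})) :
    ∃ y, RootedWeight G C j y := by
  obtain ⟨b, hb⟩ := card_pos.1 (by omega : 0 < (nbr G X {K}).card)
  obtain ⟨z, hz⟩ := h.exists_endWeight_of_three_le hIH h3 hb
  have hzj := hz.nonpos j hjK
  refine ⟨z, fun v _ => hz.lower v, fun v _ => hz.upper v, hzj, hz.total, fun k _ hadj => ?_,
    fun p hp q hq hpq hflat => absurd (hm p hp q hq hpq) hflat, fun p hp q hq r hr =>
      hz.triangle p (mem_of_mem_erase hp) q (mem_of_mem_erase hq) r (mem_of_mem_erase hr)⟩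
  have := hz.nonpos k fun hkK =>
    hjX ((h.mem_or_mem k hkK j hj hadj.symm).resolve_left hjK)
  omega

end IsEnd

namespace TwoEnds

variable {C K₁ K₂ X : Finset V} {g j : V}

lemma exists_loweredWeight (h : TwoEnds G C K₁ K₂ X) (hIH : HasRootedWeights V C.card)
    (hg : g ∈ X) : ∃ z, LoweredWeight G C K₁ K₂ X g z := by
  have h3₁ := h.card_left
  have h3₂ := h.card_right
  obtain ⟨b₁, hb₁, hb₁g⟩ := exists_mem_ne (by omega : 1 < (nbr G X {K₁}).card) g
  obtain ⟨b₂, hb₂, hb₂'⟩ : ∃ b ∈ nbr G X {K₂}, b ∉ ({g, b₁} : Finset V) := by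
    refine exists_mem_notMem_of_card_lt_card ?_
    have := card_le_two (a := g) (b := b₁)
    omega
  simp only [mem_insert, mem_singleton, not_or] at hb₂'
  obtain ⟨z₁, hz₁⟩ := h.left.exists_endWeight_of_three_le hIH h3₁ hb₁
  obtain ⟨z₂, hz₂⟩ := h.right.exists_endWeight_of_three_le hIH h3₂ hb₂
  exact ⟨_, hz₁.loweredWeight hz₂ h (nbr_subset hb₁) (nbr_subset hb₂) hg hb₁g hb₂'.1
    (Ne.symm hb₂'.2)⟩

lemma exists_excessWeight (h : TwoEnds G C K₁ K₂ X) (hIH : HasRootedWeights V C.card) :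
    ∃ y, ExcessWeight G C y := by
  have h3₁ := h.card_left
  have h3₂ := h.card_right
  obtain ⟨b₁, hb₁⟩ := card_pos.1 (by omega : 0 < (nbr G X {K₁}).card)
  obtain ⟨b₂, hb₂⟩ := card_pos.1 (by omega : 0 < (nbr G X {K₂}).card)
  obtain ⟨z₁, hz₁⟩ := h.left.exists_endWeight_of_three_le hIH h3₁ hb₁
  obtain ⟨z₂, hz₂⟩ := h.right.exists_endWeight_of_three_le hIH h3₂ hb₂
  exact ⟨_, hz₁.excessWeight_add hz₂ h.disjoint⟩

lemma exists_rootedWeight (h : TwoEnds G C K₁ K₂ X) (hIH : HasRootedWeights V C.card)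
    (hj : j ∈ C) (hj₁ : j ∉ K₁) (hj₂ : j ∉ K₂) (hg : g ∈ X) (hm : ∀ x ∈ X, x ≠ g →
      Matchable G ((C \ K₁) \ {j, x}) ∧ Matchable G ((C \ K₂) \ {j, x})) :
    ∃ y, RootedWeight G C j y := by
  obtain ⟨z, hz⟩ := h.exists_loweredWeight hIH hg
  have hm₁ : ∀ x ∈ X, x ≠ g → Matchable G ((C \ K₁) \ {j, x}) := fun x hx hxg => (hm x hx hxg).1
  have hm₂ : ∀ x ∈ X, x ≠ g → Matchable G ((C \ K₂) \ {j, x}) := fun x hx hxg => (hm x hx hxg).2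
  have hzj := hz.nonpos j hj₁ hj₂
  refine ⟨z, fun v _ => hz.lower v, fun v _ => hz.upper v, hzj, hz.total, ?_, ?_, fun p hp q hq r hr
    => hz.triangle p (mem_of_mem_erase hp) q (mem_of_mem_erase hq) r (mem_of_mem_erase hr)⟩
  · intro k _ hadj
    by_cases hjX : j ∈ X
    · have hzg := hz.gate
      rw [← h.left.eq_gate hj hj₁ hm₁ hjX] at hzg
      have := hz.upper k
      omega
    · have := hz.nonpos k
        (fun hk => hjX ((h.left.mem_or_mem k hk j hj hadj.symm).resolve_left hj₁))
        (fun hk => hjX ((h.right.mem_or_mem k hk j hj hadj.symm).resolve_left hj₂))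
      omega
  · refine pairBound_of_sorted (fun v => if v ∈ K₁ ∪ K₂ then 0 else 1) ?_
    intro p _ q hq hle
    by_cases hp₁ : p ∈ K₁
    · exact h.left.pairBound_of_gate hj hj₁ hm₁ hz.upper hz.gate hz.pair_left p hp₁ q hq
    by_cases hp₂ : p ∈ K₂
    · exact h.right.pairBound_of_gate hj hj₂ hm₂ hz.upper hz.gate hz.pair_right p hp₂ q hq
    have hq' : q ∉ K₁ ∪ K₂ := fun hq' => by simp [hp₁, hp₂, hq'] at hle
    rw [mem_union, not_or] at hq'
    have := hz.nonpos p hp₁ hp₂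
    have := hz.nonpos q hq'.1 hq'.2
    intro _ _
    omega

lemma exists_rootedWeight_of_matchable (h : TwoEnds G C K₁ K₂ X)
    (hIH : HasRootedWeights V C.card) (hj : j ∈ C)
    (hm : ∀ p ∈ C.erase j, ∀ q ∈ C.erase j, G.Adj p q → Matchable G (C \ {j, p, q})) :
    ∃ y, RootedWeight G C j y := by
  by_cases hjX : j ∈ X
  · obtain ⟨z, hz⟩ := h.exists_loweredWeight hIH hjX
    have hzj := hz.gate
    refine ⟨z, fun v _ => hz.lower v, fun v _ => hz.upper v, by omega, hz.total, fun k _ _ => ?_,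
      fun p hp q hq hpq hflat => absurd (hm p hp q hq hpq) hflat, fun p hp q hq r hr =>
      hz.triangle p (mem_of_mem_erase hp) q (mem_of_mem_erase hq) r (mem_of_mem_erase hr)⟩
    have := hz.upper k
    omega
  by_cases hj₁ : j ∈ K₁
  · exact h.right.exists_rootedWeight_of_matchable hIH h.card_right hj
      (Finset.disjoint_left.1 h.disjoint hj₁) hjX hm
  · exact h.left.exists_rootedWeight_of_matchable hIH h.card_left hj hj₁ hjX hm

end TwoEnds

lemma rootedWeight_of_matchable {C : Finset V} (h3 : 3 ≤ C.card) {j : V} (hj : j ∈ C)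
    (hpair : ∀ p ∈ C.erase j, ∀ q ∈ C.erase j, G.Adj p q → Matchable G (C \ {j, p, q}))
    (htriangle : ∀ p ∈ C.erase j, ∀ q ∈ C.erase j, ∀ r ∈ C.erase j, G.Adj p q → G.Adj q r →
      G.Adj p r → Matchable G (C \ {p, q, r})) :
    RootedWeight G C j fun v => if v = j then -1 else 1 where
  lower v _ := by grind
  upper v _ := by grind
  root := by simp
  total := by
    rw [← add_sum_erase _ _ hj, sum_congr rfl (g := fun _ => (1 : ℤ))
      fun v hv => if_neg (ne_of_mem_erase hv), sum_const, card_erase_of_mem hj]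
    simp only [if_true, nsmul_eq_mul, mul_one]
    omega
  edge k _ hadj := by simp [hadj.ne']
  pair p hp q hq hpq hflat := absurd (hpair p hp q hq hpq) hflat
  triangle p hp q hq r hr hpq hqr hpr hflat :=
    absurd (htriangle p hp q hq r hr hpq hqr hpr) hflat

lemma FactorCritical.exists_rootedWeight {C : Finset V} (hC : FactorCritical G C)
    (h3 : 3 ≤ C.card) (hIH : HasRootedWeights V C.card) {j : V} (hj : j ∈ C) :
    ∃ y, RootedWeight G C j y := by
  by_cases! hpair : ∃ p ∈ C.erase j, ∃ q ∈ C.erase j, G.Adj p q ∧ ¬ Matchable G (C \ {j, p, q})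
  · obtain ⟨p, hp, q, hq, hpq, hflat⟩ := hpair
    rw [mem_erase] at hp hq
    rcases exists_twoEnd_or_twoEnds hC hp.2 hq.2 hj hpq hp.1 hq.1
      (fun hm => hflat (hm.congr (by grind))) with
      ⟨K, W, a, b, h, hjK⟩ | ⟨K₁, K₂, X, h, hj₁, hj₂, g, hg, hm⟩
    · exact h.exists_rootedWeight_of_notMem hIH hj hjK
    · exact h.exists_rootedWeight hIH hj hj₁ hj₂ hg hm
  by_cases! htriangle : ∃ p ∈ C.erase j, ∃ q ∈ C.erase j, ∃ r ∈ C.erase j, G.Adj p q ∧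
      G.Adj q r ∧ G.Adj p r ∧ ¬ Matchable G (C \ {p, q, r})
  · obtain ⟨p, hp, q, hq, r, hr, hpq, hqr, hpr, hflat⟩ := htriangle
    rcases exists_twoEnd_or_twoEnds hC (mem_of_mem_erase hp) (mem_of_mem_erase hq)
      (mem_of_mem_erase hr) hpq hpr.ne hqr.ne hflat with
      ⟨K, W, a, b, h, -⟩ | ⟨K₁, K₂, X, h, -⟩
    · by_cases hjK : j ∈ K
      · exact h.exists_rootedWeight_of_mem hIH hjK hpair
      · exact h.exists_rootedWeight_of_notMem hIH hj hjK
    · exact h.exists_rootedWeight_of_matchable hIH hj hpair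
  exact ⟨_, rootedWeight_of_matchable h3 hj hpair htriangle⟩

lemma hasRootedWeights (n : ℕ) : HasRootedWeights V n := by
  induction n with
  | zero => exact fun _ _ _ hlt => absurd hlt (Nat.not_lt_zero _)
  | succ n ih =>
    intro G U j hlt hU h3 hj
    exact hU.exists_rootedWeight h3
      (fun G' U' j' hlt' => ih G' U' j' (by omega)) hj

lemma FactorCritical.exists_excessWeight {C : Finset V} (hC : FactorCritical G C)
    (h3 : 3 ≤ C.card) : ∃ y, ExcessWeight G C y := by
  have hIH := hasRootedWeights (V := V) C.card
  by_cases! htriangle : ∃ p ∈ C, ∃ q ∈ C, ∃ r ∈ C, G.Adj p q ∧ G.Adj q r ∧ G.Adj p r ∧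
      ¬ Matchable G (C \ {p, q, r})
  · obtain ⟨p, hp, q, hq, r, hr, hpq, hqr, hpr, hflat⟩ := htriangle
    rcases exists_twoEnd_or_twoEnds hC hp hq hr hpq hpr.ne hqr.ne hflat with
      ⟨K, W, a, b, h, -⟩ | ⟨K₁, K₂, X, h, -⟩
    · exact h.exists_excessWeight hIH
    · exact h.exists_excessWeight hIH
  refine ⟨fun _ => 1, fun _ _ => le_rfl, ?_, fun p hp q hq r hr hpq hqr hpr hflat =>
    absurd (htriangle p hp q hq r hr hpq hqr hpr) hflat⟩
  simp only [sum_const, nsmul_eq_mul, mul_one]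
  omega

end Weight

/-! ### Barriers of maximum surplus -/

section MaxBarrier

variable {V : Type*} {G : SimpleGraph V} {C S : Finset V} {𝒦 : Finset (Finset V)}

lemma Barrier.exhaust_of_maximal (h : Barrier G C S 𝒦)
    (hsurplus : ∀ S' 𝒦', Barrier G C S' 𝒦' → 𝒦'.card + S.card ≤ 𝒦.card + S'.card)
    (hsep : ∀ S' 𝒦', Barrier G C S' 𝒦' → 𝒦.card + S'.card ≤ 𝒦'.card + S.card →
      S'.card ≤ S.card) {v : V} (hv : v ∈ C) : v ∈ S ∨ ∃ K ∈ 𝒦, v ∈ K := by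
  classical
  by_contra! hnot
  have hvrest : v ∈ rest C S 𝒦 := mem_rest.2 ⟨hv, hnot⟩
  rcases Nat.even_or_odd (rest C S 𝒦).card with heven | hodd
  · obtain ⟨𝒦', h', hcard⟩ := h.exists_insert_sep hvrest heven
    have hsepcard := card_insert_of_notMem hnot.1
    have := hsep _ _ h' (by omega)
    omega
  · have := hsurplus _ _ (h.insert_rest hodd)
    rw [card_insert_rest hodd] at this
    omega

variable [DecidableEq V]

/-- A barrier exhausting `C` with factor-critical members, among those of the largest surplus
`𝒦.card - S.card`. It plays the role of the Gallai–Edmonds decomposition of `C`, with an even part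
absorbed into the separator and the members. -/
structure MaxBarrier (G : SimpleGraph V) (C S : Finset V) (𝒦 : Finset (Finset V)) : Prop
    extends Barrier G C S 𝒦 where
  factorCritical : ∀ ⦃K⦄, K ∈ 𝒦 → FactorCritical G K
  exhaust : ∀ ⦃v⦄, v ∈ C → v ∈ S ∨ ∃ K ∈ 𝒦, v ∈ K
  surplus_le : ∀ ⦃S' 𝒦'⦄, Barrier G C S' 𝒦' → 𝒦'.card + S.card ≤ 𝒦.card + S'.card

lemma exists_maxBarrier (G : SimpleGraph V) (C : Finset V) : ∃ S 𝒦, MaxBarrier G C S 𝒦 := by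
  classical
  obtain ⟨⟨S, 𝒦⟩, hmem, hmax⟩ := exists_max_image
    ((C.powerset ×ˢ C.powerset.powerset).filter fun p => Barrier G C p.1 p.2)
    (fun p => toLex ((p.2.card - p.1.card : ℤ), p.1.card)) ⟨(∅, ∅), by simp [barrier_empty]⟩
  have hB : Barrier G C S 𝒦 := (mem_filter.1 hmem).2
  have hlex : ∀ S' 𝒦', Barrier G C S' 𝒦' → (𝒦'.card - S'.card : ℤ) < 𝒦.card - S.card ∨
      (𝒦'.card - S'.card : ℤ) = 𝒦.card - S.card ∧ S'.card ≤ S.card := fun S' 𝒦' h =>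
    Prod.Lex.toLex_le_toLex.1 <| hmax (S', 𝒦') <| mem_filter.2
      ⟨mem_product.2 ⟨mem_powerset.2 h.sep_subset,
        mem_powerset.2 fun K hK => mem_powerset.2 (h.subset hK)⟩, h⟩
  have hsurplus : ∀ S' 𝒦', Barrier G C S' 𝒦' → 𝒦'.card + S.card ≤ 𝒦.card + S'.card :=
    fun S' 𝒦' h => by have := hlex S' 𝒦' h; omega
  have hsep : ∀ S' 𝒦', Barrier G C S' 𝒦' → 𝒦.card + S'.card ≤ 𝒦'.card + S.card →
      S'.card ≤ S.card := fun S' 𝒦' h _ => by have := hlex S' 𝒦' h; omega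
  refine ⟨S, 𝒦, hB, fun K hK => ?_, fun v => hB.exhaust_of_maximal hsurplus hsep, hsurplus⟩
  by_contra hnot
  obtain ⟨S', 𝒦', h', -, hlt, hle, -⟩ := hB.exists_refine_of_not_factorCritical hK hnot
  have := hsep S' 𝒦' h' (by omega)
  omega

/-- Padding the sets `t i` for `i` outside `A` by the same `Fintype.card ι - S.card` new elements
reduces this to Hall's theorem. -/
lemma exists_injective_range_of_hall {ι α : Type*} [Fintype ι] [DecidableEq α] {S : Finset α}
    {t : ι → Finset α} (ht : ∀ i, t i ⊆ S) {A : Set ι}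
    (hA : ∀ s : Finset ι, ↑s ⊆ A → s.card ≤ (s.biUnion t).card)
    (hdeficit : ∀ s : Finset ι, s.card + S.card ≤ (s.biUnion t).card + Fintype.card ι) :
    ∃ φ : S → ι, Function.Injective φ ∧ (∀ x, x.1 ∈ t (φ x)) ∧ A ⊆ Set.range φ := by
  classical
  have hS : S.card ≤ Fintype.card ι := by simpa using hdeficit ∅
  let pad (i : ι) : Finset (Fin (Fintype.card ι - S.card)) := if i ∈ A then ∅ else univ
  have hhall : ∀ s : Finset ι, s.card ≤ (s.biUnion fun i => (t i).disjSum (pad i)).card := by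
    intro s
    have hunion : (s.biUnion fun i => (t i).disjSum (pad i)) =
        (s.biUnion t).disjSum (s.biUnion pad) := by
      ext (x | x) <;> simp
    rw [hunion, card_disjSum]
    by_cases hsA : (s : Set ι) ⊆ A
    · exact (hA s hsA).trans (Nat.le_add_right _ _)
    · obtain ⟨i, hi, hiA⟩ := Set.not_subset.1 hsA
      have hpad : s.biUnion pad = univ :=
        univ_subset_iff.1 (by simpa [pad, hiA] using subset_biUnion_of_mem pad hi)
      have := hdeficit s
      rw [hpad, card_univ, Fintype.card_fin]
      omega
  obtain ⟨ψ, hψ, hψt⟩ := (all_card_le_biUnion_card_iff_exists_injective _).1 hhall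
  have himage : univ.image ψ = S.disjSum univ := by
    refine eq_of_subset_of_card_le ?_ ?_
    · exact image_subset_iff.2 fun i _ => disjSum_mono (ht i) (subset_univ _) (hψt i)
    · rw [card_image_of_injective _ hψ, card_disjSum, card_univ, card_univ, Fintype.card_fin]
      omega
  have hsurj : ∀ x : S, ∃ i, ψ i = .inl x.1 := fun x => by
    simpa using himage.ge (inl_mem_disjSum.2 x.2)
  choose φ hφ using hsurj
  refine ⟨φ, fun x y hxy => ?_, fun x => ?_, fun i hi => ?_⟩
  · exact Subtype.ext (Sum.inl_injective ((hφ x).symm.trans (hxy ▸ hφ y)))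
  · simpa [hφ] using hψt (φ x)
  · obtain ⟨x, hx, hxi⟩ : ∃ x ∈ t i, .inl x = ψ i := by simpa [pad, hi, mem_disjSum] using hψt i
    exact ⟨⟨x, ht i hx⟩, hψ ((hφ _).trans hxi)⟩

lemma MaxBarrier.exists_injective_range_of_hall (h : MaxBarrier G C S 𝒦) {P : Finset V → Prop}
    (hall : ∀ 𝒦' ⊆ 𝒦, (∀ K ∈ 𝒦', P K) → 𝒦'.card ≤ (nbr G S 𝒦').card) :
    ∃ φ : S → 𝒦, Function.Injective φ ∧ (∀ s, ∃ k ∈ (φ s).1, G.Adj s k) ∧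
      ∀ K : 𝒦, P K → K ∈ Set.range φ := by
  have hmem (s : Finset 𝒦) : s.map (.subtype _) ⊆ 𝒦 := fun _ => property_of_mem_map_subtype s
  have hP : ∀ s : Finset 𝒦, (s : Set 𝒦) ⊆ {K | P K} →
      s.card ≤ (s.biUnion fun K => nbr G S {K.1}).card := by
    intro s hs
    rw [biUnion_nbr_singleton, ← card_map (.subtype _)]
    exact hall _ (hmem s) (by simpa using fun K hK hKs => hs (mem_coe.2 hKs))
  have hdeficit : ∀ s : Finset 𝒦,
      s.card + S.card ≤ (s.biUnion fun K => nbr G S {K.1}).card + Fintype.card 𝒦 := by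
    intro s
    have := h.surplus_le (h.restrict (hmem s))
    rw [card_map] at this
    rw [biUnion_nbr_singleton, Fintype.card_coe]
    omega
  obtain ⟨φ, hφ, hadj, hrange⟩ :=
    ExtendedMatching.exists_injective_range_of_hall (fun _ => nbr_subset) hP hdeficit
  exact ⟨φ, hφ, fun s => (mem_nbr_singleton.1 (hadj s)).2, fun K hK => hrange hK⟩

/-- The member `K` of `𝒦` together with the vertices of `S` that `φ` assigns to it. -/
def attached (φ : S → 𝒦) (K : 𝒦) : Finset V :=
  K.1 ∪ (univ.filter fun s => φ s = K).map (.subtype _)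

lemma mem_attached {φ : S → 𝒦} {K : 𝒦} {v : V} :
    v ∈ attached φ K ↔ v ∈ K.1 ∨ ∃ s : S, φ s = K ∧ s.1 = v := by
  simp [attached]

lemma Barrier.pairwiseDisjoint_attached (h : Barrier G C S 𝒦) (φ : S → 𝒦) :
    ((univ : Finset 𝒦) : Set 𝒦).PairwiseDisjoint (attached φ) := by
  intro K _ L _ hne
  refine Finset.disjoint_left.2 fun v hvK hvL => hne ?_
  rcases mem_attached.1 hvK with hvK | ⟨s, rfl, rfl⟩ <;>
    rcases mem_attached.1 hvL with hvL | ⟨s', rfl, hs'⟩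
  · exact Subtype.ext (h.eq_of_mem K.2 L.2 hvK hvL)
  · exact absurd (hs' ▸ s'.2) (h.notMem K.2 hvK)
  · exact absurd s.2 (h.notMem L.2 hvL)
  · rw [Subtype.ext hs']

lemma MaxBarrier.biUnion_attached (h : MaxBarrier G C S 𝒦) (φ : S → 𝒦) :
    univ.biUnion (attached φ) = C := by
  ext v
  simp only [mem_biUnion, mem_univ, true_and, mem_attached]
  refine ⟨?_, fun hv => ?_⟩
  · rintro ⟨K, hv | ⟨s, -, rfl⟩⟩
    · exact h.subset K.2 hv
    · exact h.sep_subset s.2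
  · rcases h.exhaust hv with hvS | ⟨K, hK, hvK⟩
    · exact ⟨φ ⟨v, hvS⟩, .inr ⟨⟨v, hvS⟩, rfl, rfl⟩⟩
    · exact ⟨⟨K, hK⟩, .inl hvK⟩

end MaxBarrier

/-! ### Covering by hyperedges and pairs -/

section Hypergraph

variable {V E : Type*} {H : MultiHypergraph V E} {T : Set V}

/-- The graph in which two distinct nodes are adjacent if they lie in a common hyperedge, so that
its edges are the pairs allowed in an extended matching. -/
def primalGraph (H : MultiHypergraph V E) : SimpleGraph V where
  Adj u v := u ≠ v ∧ ∃ e, u ∈ H.edge e ∧ v ∈ H.edge e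
  symm := ⟨fun _ _ h => ⟨h.1.symm, h.2.imp fun _ he => he.symm⟩⟩
  loopless := ⟨fun _ h => h.1 rfl⟩

lemma primalGraph_adj {u v : V} :
    (primalGraph H).Adj u v ↔ u ≠ v ∧ ∃ e, u ∈ H.edge e ∧ v ∈ H.edge e :=
  Iff.rfl

/-- Some extended matching whose members lie inside `U` covers all nodes of `U` in `T`. -/
def Coverable (H : MultiHypergraph V E) (T : Set V) (U : Finset V) : Prop :=
  ∃ M : Finset (Finset V), H.IsExtendedMatching M ∧ (∀ s ∈ M, s ⊆ U) ∧
    ∀ v ∈ U, v ∈ T → ∃ s ∈ M, v ∈ s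

variable [DecidableEq V]

lemma Coverable.biUnion {ι : Type*} {s : Finset ι} {t : ι → Finset V}
    (h : ∀ i ∈ s, Coverable H T (t i)) (hd : (s : Set ι).PairwiseDisjoint t) :
    Coverable H T (s.biUnion t) := by
  choose! M hM hsub hcover using h
  refine ⟨s.biUnion M, ⟨?_, ?_⟩, ?_, ?_⟩
  · simp only [mem_biUnion, forall_exists_index, and_imp]
    exact fun u i hi hu => (hM i hi).1 u hu
  · intro u hu v hv hne
    obtain ⟨i, hi, hu⟩ := mem_biUnion.1 (mem_coe.1 hu)
    obtain ⟨k, hk, hv⟩ := mem_biUnion.1 (mem_coe.1 hv)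
    rcases eq_or_ne i k with rfl | hik
    · exact (hM i hi).2 hu hv hne
    · exact (hd hi hk hik).mono (hsub i hi u hu) (hsub k hk v hv)
  · simp only [mem_biUnion, forall_exists_index, and_imp]
    exact fun u i hi hu => (hsub i hi u hu).trans (subset_biUnion_of_mem t hi)
  · simp only [mem_biUnion, forall_exists_index, and_imp]
    intro v i hi hv hvT
    obtain ⟨u, hu, hvu⟩ := hcover i hi v hv hvT
    exact ⟨u, ⟨i, hi, hu⟩, hvu⟩

lemma Coverable.of_sdiff {U s : Finset V}
    (hs : (∃ e, s = H.edge e) ∨ (s.card = 2 ∧ ∃ e, s ⊆ H.edge e)) (hsU : s ⊆ U)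
    (h : Coverable H T (U \ s)) : Coverable H T U := by
  obtain ⟨M, hM, hsub, hcover⟩ := h
  refine ⟨insert s M, ⟨(forall_mem_insert _ _ _).2 ⟨hs, hM.1⟩, ?_⟩,
    (forall_mem_insert _ _ _).2 ⟨hsU, fun t ht => (hsub t ht).trans sdiff_subset⟩,
    fun v hv hvT => ?_⟩
  · rw [coe_insert]
    exact hM.2.insert_of_symm
      fun t ht _ => (disjoint_sdiff_self_left.mono_left (hsub t ht)).symm
  · by_cases hvs : v ∈ s
    · exact ⟨s, mem_insert_self _ _, hvs⟩
    · obtain ⟨t, ht, hvt⟩ := hcover v (mem_sdiff.2 ⟨hv, hvs⟩) hvT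
      exact ⟨t, mem_insert_of_mem ht, hvt⟩

lemma Coverable.of_erase {U : Finset V} {v : V} (hv : v ∉ T) (h : Coverable H T (U.erase v)) :
    Coverable H T U := by
  obtain ⟨M, hM, hsub, hcover⟩ := h
  refine ⟨M, hM, fun s hs => (hsub s hs).trans (erase_subset _ _), fun u hu huT => ?_⟩
  exact hcover u (mem_erase.2 ⟨ne_of_mem_of_not_mem huT hv, hu⟩) huT

omit [DecidableEq V] in
lemma Matchable.coverable {U : Finset V} (h : Matchable (primalGraph H) U) : Coverable H T U := by
  classical
  induction U using Finset.strongInduction with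
  | H U ih =>
    obtain rfl | ⟨x, hx⟩ := U.eq_empty_or_nonempty
    · exact ⟨∅, by simp [MultiHypergraph.IsExtendedMatching], by simp, by simp⟩
    obtain ⟨u, hu, hadj, hrest⟩ := h.exists_partner hx
    obtain ⟨hne, e, hxe, hue⟩ := primalGraph_adj.1 hadj
    have hpair : {x, u} ⊆ U := insert_subset hx (singleton_subset_iff.2 hu)
    exact .of_sdiff (.inr ⟨card_pair hne, e, insert_subset hxe (singleton_subset_iff.2 hue)⟩) hpair
      (ih _ (sdiff_ssubset hpair (insert_nonempty _ _)) hrest)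

/-- A subset of `T` that cannot be partitioned into a hyperedge and pairs of adjacent nodes. For a
factor-critical set this is the only obstruction to being coverable. -/
def Obstructed (H : MultiHypergraph V E) (T : Set V) (K : Finset V) : Prop :=
  ↑K ⊆ T ∧ ∀ e, H.edge e ⊆ K → ¬ Matchable (primalGraph H) (K \ H.edge e)

lemma FactorCritical.coverable {K : Finset V} (hK : FactorCritical (primalGraph H) K)
    (h : ¬ Obstructed H T K) : Coverable H T K := by
  rw [Obstructed, not_and_or, Set.not_subset] at h
  push Not at h
  rcases h with ⟨v, hv, hvT⟩ | ⟨e, he, hm⟩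
  · exact .of_erase hvT (hK.2 v hv).coverable
  · exact .of_sdiff (.inl ⟨e, rfl⟩) he hm.coverable

lemma MaxBarrier.coverable_attached {C S : Finset V} {𝒦 : Finset (Finset V)}
    (h : MaxBarrier (primalGraph H) C S 𝒦) {φ : S → 𝒦} (hφ : Function.Injective φ)
    (hadj : ∀ s, ∃ k ∈ (φ s).1, (primalGraph H).Adj s k)
    (hrange : ∀ K : 𝒦, Obstructed H T K → K ∈ Set.range φ) (K : 𝒦) :
    Coverable H T (attached φ K) := by
  by_cases hK : K ∈ Set.range φ
  · obtain ⟨s, rfl⟩ := hK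
    obtain ⟨k, hk, hsk⟩ := hadj s
    have hsφ : s.1 ∉ (φ s).1 := fun hs => h.notMem (φ s).2 hs s.2
    refine (((h.factorCritical (φ s).2).matchable_insert hsφ hk hsk).congr fun v => ?_).coverable
    simp [mem_attached, hφ.eq_iff, or_comm, eq_comm]
  · have heq : attached φ K = K.1 := by
      ext v
      rw [mem_attached, or_iff_left]
      exact fun ⟨s, hs, _⟩ => hK ⟨s, hs⟩
    rw [heq]
    exact (h.factorCritical K.2).coverable fun hobs => hK (hrange K hobs)

lemma MaxBarrier.coverable {C S : Finset V} {𝒦 : Finset (Finset V)}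
    (h : MaxBarrier (primalGraph H) C S 𝒦)
    (hφ : ∃ φ : S → 𝒦, Function.Injective φ ∧
      (∀ s, ∃ k ∈ (φ s).1, (primalGraph H).Adj s k) ∧
      ∀ K : 𝒦, Obstructed H T K → K ∈ Set.range φ) : Coverable H T C := by
  obtain ⟨φ, hφ, hadj, hrange⟩ := hφ
  rw [← h.biUnion_attached φ]
  exact .biUnion (fun K _ => h.coverable_attached hφ hadj hrange K) (h.pairwiseDisjoint_attached φ)

lemma ExcessWeight.sum_inter_edge_le {K : Finset V} {y : V → ℤ}
    (hy : ExcessWeight (primalGraph H) K y) (hK : Obstructed H T K) {e : E}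
    (he : (H.edge e).card = 3) : ∑ v ∈ H.edge e ∩ K, y v ≤ 2 * (H.edge e \ K).card := by
  by_cases hsub : H.edge e ⊆ K
  · have hflat := hK.2 e hsub
    have hadj : ∀ u ∈ H.edge e, ∀ v ∈ H.edge e, u ≠ v → (primalGraph H).Adj u v :=
      fun u hu v hv huv => primalGraph_adj.2 ⟨huv, e, hu, hv⟩
    rw [inter_eq_left.2 hsub, sdiff_eq_empty_iff_subset.2 hsub]
    obtain ⟨p, q, r, hpq, hpr, hqr, heq⟩ := card_eq_three.1 he
    simp only [heq, insert_subset_iff, singleton_subset_iff, forall_mem_insert] at hsub hflat hadj ⊢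
    have htri := hy.triangle p hsub.1 q hsub.2.1 r hsub.2.2 (hadj.1.2.1 hpq)
      (hadj.2.1.2.2 r (mem_singleton_self r) hqr) (hadj.1.2.2 r (mem_singleton_self r) hpr) hflat
    rw [sum_insert (by simp [hpq, hpr]), sum_pair hqr]
    simpa [add_assoc] using htri
  · have hupper : ∑ v ∈ H.edge e ∩ K, y v ≤ ((H.edge e ∩ K).card : ℤ) := by
      simpa using sum_le_card_nsmul _ y 1 fun v hv => hy.upper v (mem_inter.1 hv).2
    have houtside : 0 < (H.edge e \ K).card := card_pos.2 (sdiff_nonempty.2 hsub)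
    have := card_inter_add_card_sdiff (H.edge e) K
    omega

lemma Barrier.sum_card_edge_sdiff_le [Fintype V] {S : Finset V} {𝒦 : Finset (Finset V)}
    (h : Barrier (primalGraph H) univ S 𝒦) (e : E) :
    ∑ K ∈ 𝒦 with (H.edge e ∩ K).Nonempty, (H.edge e \ K).card ≤ (H.edge e ∩ S).card := by
  have hmem : ∀ K ∈ 𝒦, (H.edge e ∩ K).Nonempty → ∀ v ∈ H.edge e, v ∈ K ∨ v ∈ S := by
    rintro K hK ⟨k, hk⟩ v hv
    obtain ⟨hke, hkK⟩ := mem_inter.1 hk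
    rcases eq_or_ne k v with rfl | hne
    · exact .inl hkK
    · exact h.mem_or_mem hK hkK (mem_univ v) (primalGraph_adj.2 ⟨hne, e, hke, hv⟩)
  obtain hempty | ⟨K, hK⟩ := (𝒦.filter fun K => (H.edge e ∩ K).Nonempty).eq_empty_or_nonempty
  · simp [hempty]
  have hK' := mem_filter.1 hK
  rw [sum_eq_single_of_mem K hK]
  · refine card_le_card fun v hv => ?_
    obtain ⟨hve, hvK⟩ := mem_sdiff.1 hv
    exact mem_inter.2 ⟨hve, (hmem K hK'.1 hK'.2 v hve).resolve_left hvK⟩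
  · intro L hL hne
    obtain ⟨hL𝒦, l, hl⟩ := mem_filter.1 hL
    obtain ⟨hle, hlL⟩ := mem_inter.1 hl
    rcases hmem K hK'.1 hK'.2 l hle with hlK | hlS
    · exact absurd (h.eq_of_mem hL𝒦 hK'.1 hlL hlK) hne
    · exact absurd hlS (h.notMem hL𝒦 hlL)

variable [Fintype E]

/-- The number of incidences outside `K` of the hyperedges meeting `K`. -/
def cost (H : MultiHypergraph V E) (K : Finset V) : ℕ :=
  ∑ e with (H.edge e ∩ K).Nonempty, (H.edge e \ K).card

lemma degree_le_cost_singleton (hH : ∀ e, 2 ≤ (H.edge e).card) (v : V) :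
    H.degree v ≤ cost H {v} := by
  have hfilter : (univ.filter fun e => (H.edge e ∩ {v}).Nonempty) =
      univ.filter fun e => v ∈ H.edge e := by
    simp [← not_disjoint_iff_nonempty_inter]
  rw [cost, MultiHypergraph.degree, hfilter, card_eq_sum_ones]
  refine sum_le_sum fun e he => ?_
  rw [card_sdiff_of_subset (singleton_subset_iff.2 (mem_filter.1 he).2), card_singleton]
  have := hH e
  omega

lemma sum_mul_degree (y : V → ℤ) (K : Finset V) :
    ∑ v ∈ K, y v * H.degree v = ∑ e, ∑ v ∈ H.edge e ∩ K, y v := by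
  simp only [MultiHypergraph.degree, mul_comm (y _), ← nsmul_eq_mul, ← sum_const]
  exact sum_comm' (by simp [and_comm])

lemma ExcessWeight.le_cost {K : Finset V} {y : V → ℤ} (hy : ExcessWeight (primalGraph H) K y)
    (hH : H.IsUniform 3) {Δ : ℕ} (hΔ : ∀ v ∈ T, H.degree v = Δ) (hK : Obstructed H T K) :
    Δ ≤ cost H K := by
  have hdegree : ∑ v ∈ K, y v * H.degree v = (∑ v ∈ K, y v) * Δ := by
    rw [sum_mul]
    exact sum_congr rfl fun v hv => by rw [hΔ v (hK.1 hv)]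
  have hcost : ∑ e, ∑ v ∈ H.edge e ∩ K, y v ≤ 2 * (cost H K : ℤ) := by
    rw [cost, Nat.cast_sum, mul_sum, ← sum_filter_of_ne fun e _ hne => nonempty_of_sum_ne_zero hne]
    exact sum_le_sum fun e _ => hy.sum_inter_edge_le hK (hH e)
  have htotal : (2 : ℤ) * Δ ≤ (∑ v ∈ K, y v) * Δ :=
    mul_le_mul_of_nonneg_right hy.total (by positivity)
  rw [← sum_mul_degree, hdegree] at hcost
  omega

lemma FactorCritical.le_cost {K : Finset V} (h : FactorCritical (primalGraph H) K)
    (hH : H.IsUniform 3) {Δ : ℕ} (hΔ : ∀ v ∈ T, H.degree v = Δ) (hK : Obstructed H T K) :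
    Δ ≤ cost H K := by
  rcases Nat.lt_or_ge K.card 3 with hlt | hle
  · obtain ⟨v, rfl⟩ := card_eq_one.1 (show K.card = 1 by have := h.odd_card; grind)
    rw [← hΔ v (by simpa using hK.1)]
    exact degree_le_cost_singleton (fun e => by rw [hH e]; norm_num) v
  · obtain ⟨y, hy⟩ := h.exists_excessWeight hle
    exact hy.le_cost hH hΔ hK

variable [Fintype V]

lemma Barrier.sum_cost_le {S : Finset V} {𝒦 : Finset (Finset V)}
    (h : Barrier (primalGraph H) univ S 𝒦) : ∑ K ∈ 𝒦, cost H K ≤ ∑ v ∈ S, H.degree v :=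
  calc ∑ K ∈ 𝒦, cost H K
      = ∑ e, ∑ K ∈ 𝒦 with (H.edge e ∩ K).Nonempty, (H.edge e \ K).card :=
        sum_comm' (by simp [and_comm])
    _ ≤ ∑ e, (H.edge e ∩ S).card := sum_le_sum fun e _ => h.sum_card_edge_sdiff_le e
    _ = ∑ v ∈ S, H.degree v := by
        simpa [← Nat.cast_inj (R := ℤ)] using (sum_mul_degree (H := H) 1 S).symm

lemma Barrier.card_le_card_nbr {S : Finset V} {𝒦 : Finset (Finset V)}
    (h : Barrier (primalGraph H) univ S 𝒦) {Δ : ℕ} (hpos : 0 < Δ) (hle : ∀ v, H.degree v ≤ Δ)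
    (hcost : ∀ K ∈ 𝒦, Δ ≤ cost H K) : 𝒦.card ≤ (nbr (primalGraph H) S 𝒦).card := by
  refine Nat.le_of_mul_le_mul_right ?_ hpos
  calc 𝒦.card * Δ
      ≤ ∑ K ∈ 𝒦, cost H K := by simpa using card_nsmul_le_sum 𝒦 (cost H) Δ hcost
    _ ≤ ∑ v ∈ nbr (primalGraph H) S 𝒦, H.degree v := (h.restrict subset_rfl).sum_cost_le
    _ ≤ (nbr (primalGraph H) S 𝒦).card * Δ := by
        simpa using sum_le_card_nsmul (nbr (primalGraph H) S 𝒦) _ Δ fun v _ => hle v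

lemma MaxBarrier.coverable_univ {S : Finset V} {𝒦 : Finset (Finset V)}
    (h : MaxBarrier (primalGraph H) univ S 𝒦) (hH : H.IsUniform 3) {Δ : ℕ} (hpos : 0 < Δ)
    (hle : ∀ v, H.degree v ≤ Δ) (hΔ : ∀ v ∈ T, H.degree v = Δ) : Coverable H T univ := by
  refine h.coverable (h.exists_injective_range_of_hall fun 𝒦' h𝒦' hobs => ?_)
  have hcost : ∀ K ∈ 𝒦', Δ ≤ cost H K := fun K hK =>
    (h.factorCritical (h𝒦' hK)).le_cost hH hΔ (hobs K hK)
  simpa [nbr_nbr subset_rfl] using (h.restrict h𝒦').card_le_card_nbr hpos hle hcost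

end Hypergraph

end ExtendedMatching

theorem mainTheorem3 {V E : Type*} [Fintype V] [DecidableEq V] [Fintype E] [Nonempty E]
    (H : MultiHypergraph V E) (hH : H.IsUniform 3) :
    ∃ M : Finset (Finset V), H.IsExtendedMatching M ∧
      ∀ v, H.IsMaxDegree v → ∃ s ∈ M, v ∈ s := by
  obtain ⟨e⟩ := ‹Nonempty E›
  obtain ⟨u, hu⟩ := Finset.card_pos.1 (by rw [hH e]; norm_num : 0 < (H.edge e).card)
  obtain ⟨m, -, hm⟩ := Finset.exists_max_image Finset.univ H.degree ⟨u, Finset.mem_univ u⟩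
  have hmax : H.IsMaxDegree m := fun v => hm v (Finset.mem_univ v)
  have hpos : 0 < H.degree m :=
    (Finset.card_pos.2 ⟨e, by simpa using hu⟩ : 0 < H.degree u).trans_le (hmax u)
  obtain ⟨S, 𝒦, hB⟩ := ExtendedMatching.exists_maxBarrier (ExtendedMatching.primalGraph H) .univ
  obtain ⟨M, hM, -, hcover⟩ := hB.coverable_univ (T := {v | H.IsMaxDegree v}) hH hpos hmax
    fun v hv => le_antisymm (hmax v) (hv m)
  exact ⟨M, hM, fun v hv => hcover v (Finset.mem_univ v) hv⟩
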